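/- Let $\varrho$ be any state on $\mathcal H_A\otimes\mathcal H_B$ ($\mathcal H_A,\mathcal H_B$ finite dimensional). A CLOCC operation is a finite composition of local unitary transformations and of transmissions of a subsystem (any tensor factor of the space held by one party) to the other party through a completely dephasing channel $\sigma\mapsto\sum_i P_i\sigma P_i$, where the $P_i$ are the rank-one projectors onto an orthonormal basis of the subsystem. For a state $\sigma$ on a space of dimension $d$ let $I(\sigma)=\log_2 d+\operatorname{tr}\sigma\log_2\sigma$ (so $I=0$ if $d=1$), and for a bipartite state $\varrho$ let the localisable information be $$I_l(\varrho)=\sup_{\Lambda\in\mathrm{CLOCC}}\bigl(I(\varrho'_A)+I(\varrho'_B)\bigr),\qquad \varrho'=\Lambda(\varrho),$$ where $\varrho'_A,\varrho'_B$ are the reduced states of the two parties. The optimal net amount of local information obtainable with borrowed local pure ancillas (catalysis) is $$I_l^{\mathrm{cat}}(\varrho)=\sup_{\mathcal H_{A_0},\mathcal H_{B_0},\varphi,\chi}\Bigl(I_l\bigl(\varrho\otimes|\varphi\rangle\langle\varphi|_{A_0}\otimes|\chi\rangle\langle\chi|_{B_0}\bigr)-\log_2\dim\mathcal H_{A_0}-\log_2\dim\mathcal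 H_{B_0}\Bigr),$$ where the supremum is over all finite-dimensional ancilla spaces $\mathcal H_{A_0}$ (held by Alice) and $\mathcal H_{B_0}$ (held by Bob) and all unit vectors $\varphi\in\mathcal H_{A_0}$, $\chi\in\mathcal H_{B_0}$. Theorem. Local pure ancillas do not help in distilling local information asymptotically: (1) the limit $I_l^\infty(\varrho)=\lim_{n\to\infty}\frac1n I_l(\varrho^{\otimes n})$ exists and is finite; (2) $I_l^{\mathrm{cat}}(\varrho^{\otimes n})$ is finite for every $n$, and $$\lim_{n\to\infty}\frac1n I_l^{\mathrm{cat}}(\varrho^{\otimes n})=I_l^\infty(\varrho);$$ (3) for all finite-dimensional $\mathcal H_{A_0},\mathcal H_{B_0}$ and all unit vectors $\varphi\in\mathcal H_{A_0}$, $\chi\in\mathcal H_{B_0}$, the limit defining the left side exists and $$I_l^\infty\bigl(\varrho\otimes|\varphi\rangle\langle\varphi|_{A_0}\otimes|\chi\rangle\langle\chi|_{B_0}\bigr)=I_l^\infty(\varrho)+\log_2\dim\mathcal H_{A_0}+\log_2\dim\mathcal H_{B_0}.$$ -/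

import Mathlib

open Filter Topology
open scoped Matrix Kronecker ComplexOrder

noncomputable section

namespace LocalInfo

/-- Operators on `ℂ^A ⊗ ℂ^B`, where the finite types `A`, `B` label the standard bases of
the Hilbert spaces of Alice and Bob. -/
abbrev BiOp (A B : Type) : Type := Matrix (A × B) (A × B) ℂ

/-- Density operators on `ℂ^X`. -/
structure IsState {X : Type} [Fintype X] (ρ : Matrix X X ℂ) : Prop where
  posSemidef : ρ.PosSemidef
  trace_eq_one : ρ.trace = 1

/-- The von Neumann entropy `-tr ρ log₂ ρ`, computed from the eigenvalues of `ρ`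
(`0` by convention if `ρ` is not Hermitian). -/
def entropy {X : Type} [Fintype X] [DecidableEq X] (ρ : Matrix X X ℂ) : ℝ :=
  open Classical in
  if h : ρ.IsHermitian then ∑ i, Real.negMulLog (h.eigenvalues i) / Real.log 2 else 0

/-- The information function `I(ρ) = log₂ d - S(ρ)` of a state on a space of dimension `d`.
It vanishes on a null subsystem (`d = 1`). -/
def info {X : Type} [Fintype X] [DecidableEq X] (ρ : Matrix X X ℂ) : ℝ :=
  Real.logb 2 (Fintype.card X) - entropy ρ

/-- The reduced operator of Alice. -/
def marginalA {A B : Type} [Fintype B] (ρ : BiOp A B) : Matrix A A ℂ :=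
  Matrix.of fun a a' => ∑ b, ρ (a, b) (a', b)

/-- The reduced operator of Bob. -/
def marginalB {A B : Type} [Fintype A] (ρ : BiOp A B) : Matrix B B ℂ :=
  Matrix.of fun b b' => ∑ a, ρ (a, b) (a, b')

/-- Conjugation by the local unitary `U ⊗ V`. -/
def localUnitary {A B : Type} [Fintype A] [DecidableEq A] [Fintype B] [DecidableEq B]
    (U : Matrix.unitaryGroup A ℂ) (V : Matrix.unitaryGroup B ℂ) (ρ : BiOp A B) : BiOp A B :=
  ((U : Matrix A A ℂ) ⊗ₖ (V : Matrix B B ℂ)) * ρ *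
    ((U : Matrix A A ℂ) ⊗ₖ (V : Matrix B B ℂ))ᴴ

/-- Local renaming of the basis labels; with `A' = X × Y` it fixes a splitting of Alice's system
into subsystems `X` and `Y`. -/
def relabel {A B A' B' : Type} (e : A ≃ A') (f : B ≃ B') (ρ : BiOp A B) : BiOp A' B' :=
  Matrix.of fun i j => ρ (e.symm i.1, f.symm i.2) (e.symm j.1, f.symm j.2)

/-- Alice sends her subsystem `X` to Bob down the completely dephasing channel
`σ ↦ ∑ x, |x⟩⟨x| σ |x⟩⟨x|`. -/
def sendToBob {X A B : Type} [DecidableEq X] (ρ : BiOp (X × A) B) : BiOp A (X × B) :=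
  Matrix.of fun i j =>
    if i.2.1 = j.2.1 then ρ ((i.2.1, i.1), i.2.2) ((j.2.1, j.1), j.2.2) else 0

/-- Bob sends his subsystem `X` to Alice down the completely dephasing channel. -/
def sendToAlice {X A B : Type} [DecidableEq X] (ρ : BiOp A (X × B)) : BiOp (X × A) B :=
  Matrix.of fun i j =>
    if i.1.1 = j.1.1 then ρ (i.1.2, (i.1.1, i.2)) (j.1.2, (j.1.1, j.2)) else 0

/-- Closed LOCC operations: all operations composed of finitely many local unitaries and
transmissions of subsystems through a completely dephasing channel. Since local unitaries are
free, the sent subsystem is an arbitrary tensor factor and the dephasing basis is an arbitrary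
orthonormal basis of it. -/
inductive IsCLOCC : ∀ {A B A' B' : Type} [Fintype A] [DecidableEq A] [Fintype B] [DecidableEq B]
    [Fintype A'] [DecidableEq A'] [Fintype B'] [DecidableEq B'],
    (BiOp A B → BiOp A' B') → Prop
  | localUnitary {A B : Type} [Fintype A] [DecidableEq A] [Fintype B] [DecidableEq B]
      (U : Matrix.unitaryGroup A ℂ) (V : Matrix.unitaryGroup B ℂ) :
      IsCLOCC (localUnitary U V)
  | relabel {A B A' B' : Type} [Fintype A] [DecidableEq A] [Fintype B] [DecidableEq B]
      [Fintype A'] [DecidableEq A'] [Fintype B'] [DecidableEq B'] (e : A ≃ A') (f : B ≃ B') :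
      IsCLOCC (relabel e f)
  | sendToBob {X A B : Type} [Fintype X] [DecidableEq X] [Fintype A] [DecidableEq A]
      [Fintype B] [DecidableEq B] :
      IsCLOCC (sendToBob : BiOp (X × A) B → BiOp A (X × B))
  | sendToAlice {X A B : Type} [Fintype X] [DecidableEq X] [Fintype A] [DecidableEq A]
      [Fintype B] [DecidableEq B] :
      IsCLOCC (sendToAlice : BiOp A (X × B) → BiOp (X × A) B)
  | comp {A B A' B' A'' B'' : Type} [Fintype A] [DecidableEq A] [Fintype B] [DecidableEq B]
      [Fintype A'] [DecidableEq A'] [Fintype B'] [DecidableEq B']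
      [Fintype A''] [DecidableEq A''] [Fintype B''] [DecidableEq B'']
      {Λ : BiOp A B → BiOp A' B'} {Λ' : BiOp A' B' → BiOp A'' B''}
      (hΛ' : IsCLOCC Λ') (hΛ : IsCLOCC Λ) : IsCLOCC (Λ' ∘ Λ)

/-- The values `I(ρ'_A) + I(ρ'_B)` for the outputs `ρ' = Λ(ρ)` of CLOCC operations `Λ`. -/
def locInfoSet {A B : Type} [Fintype A] [DecidableEq A] [Fintype B] [DecidableEq B]
    (ρ : BiOp A B) : Set ℝ :=
  {x | ∃ (A' B' : Type) (_ : Fintype A') (_ : DecidableEq A') (_ : Fintype B')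
    (_ : DecidableEq B') (Λ : BiOp A B → BiOp A' B'),
    IsCLOCC Λ ∧ x = info (marginalA (Λ ρ)) + info (marginalB (Λ ρ))}

/-- The localisable information `I_l(ρ)`. -/
def locInfo {A B : Type} [Fintype A] [DecidableEq A] [Fintype B] [DecidableEq B]
    (ρ : BiOp A B) : ℝ :=
  sSup (locInfoSet ρ)

/-- The tensor power `ρ^{⊗ n}`, with the `n` systems of Alice grouped together and the `n`
systems of Bob grouped together. -/
def tensorPow {A B : Type} (n : ℕ) (ρ : BiOp A B) : BiOp (Fin n → A) (Fin n → B) :=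
  Matrix.of fun i j => ∏ k, ρ (i.1 k, i.2 k) (j.1 k, j.2 k)

/-- The state `ρ ⊗ |φ⟩⟨φ| ⊗ |χ⟩⟨χ|`, the ancilla `φ` being with Alice and `χ` with Bob. -/
def withAncilla {A B A₀ B₀ : Type} (ρ : BiOp A B)
    (φ : EuclideanSpace ℂ A₀) (χ : EuclideanSpace ℂ B₀) : BiOp (A × A₀) (B × B₀) :=
  Matrix.of fun i j => ρ (i.1.1, i.2.1) (j.1.1, j.2.1) *
    (φ i.1.2 * star (φ j.1.2)) * (χ i.2.2 * star (χ j.2.2))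

/-- The net amounts of local information that can be obtained from `ρ` with borrowed local pure
ancillas: the localisable information in the presence of the ancillas, minus the information
`log₂ |A₀| + log₂ |B₀|` that was borrowed. Ancillas of all finite dimensions are allowed. -/
def catLocInfoSet {A B : Type} [Fintype A] [DecidableEq A] [Fintype B] [DecidableEq B]
    (ρ : BiOp A B) : Set ℝ :=
  {x | ∃ (A₀ B₀ : Type) (_ : Fintype A₀) (_ : DecidableEq A₀) (_ : Fintype B₀)
    (_ : DecidableEq B₀) (φ : EuclideanSpace ℂ A₀) (χ : EuclideanSpace ℂ B₀),
    ‖φ‖ = 1 ∧ ‖χ‖ = 1 ∧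
    x = locInfo (withAncilla ρ φ χ) -
      (Real.logb 2 (Fintype.card A₀) + Real.logb 2 (Fintype.card B₀))}

/-- The optimal net amount of local information with borrowed local pure ancillas. -/
def catLocInfo {A B : Type} [Fintype A] [DecidableEq A] [Fintype B] [DecidableEq B]
    (ρ : BiOp A B) : ℝ :=
  sSup (catLocInfoSet ρ)

end LocalInfo

end

set_option linter.unusedSectionVars false

noncomputable section

namespace LocalInfo

/-! ### Linearity of CLOCC operations and their action on matrix units. -/

section Linearity

/-! A protocol neither adds nor discards systems, so the total dimension is fixed and extracting
information means ending with small entropy. Rotating to eigenbases of the reduced states, dephasing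
everything and using subadditivity, one may assume that a protocol ends with a classical
distribution `p` held by Bob, of value log₂ dim − H(p) (`exists_bobDist_of_mem_locInfoSet`).

Let d = |A||B| and L = log₂ d. The core is `sub_shannon_le_of_forall_locInfo_le`: if R bounds the
localisable information per copy for every number of copies, then a protocol with ancillas has net
gain L − H(p) ≤ R. For ρ = 1/d this is a matter of unitality: with its ancillas the state is at most
1/d times the identity, protocols are positive and unital, so every output probability is at most
1/d and H(p) ≥ L. Otherwise a local rotation followed by dephasing gives H(p₀) < L on one copy, and
compressing the typical set of C·N copies produces blank registers on both sides
(`eventually_yieldsBlanks_seed`).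

A simulation that keeps both local dimensions fixed turns the ancilla protocol into one on ρ
together with a blank register of dimension d^M at each party (`exists_register_protocol`). If N of
these are run in parallel and the classical output is compressed, the registers come back blank with
weight close to one, and about N·H(p) bits of entropy remain in N systems of dimension d. So the
registers are recycled: k rounds need a single seed, whose cost C·N·L does not depend on k
(`eventually_yieldsBlanks`). The yield from (C + k)·N copies is about k·N·(L − H(p)), and for large
k it would exceed (C + k)·N·R if L − H(p) > R.

Superadditivity and Fekete's lemma give the regularised limit r as a supremum over n. The core
result applied to ρ^{⊗n} with R = n·r bounds the catalytic quantity by n·r; the converse is trivial.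
Ancillas attached to each copy of ρ form a single ancilla for ρ^{⊗n}, which gives the last claim by
squeezing. -/

theorem isLinearMap_ext_single {I J : Type} [Fintype I] [DecidableEq I] [Fintype J] [DecidableEq J]
    {F G : Matrix I I ℂ → Matrix J J ℂ} (hF : IsLinearMap ℂ F) (hG : IsLinearMap ℂ G)
    (h : ∀ i j c, F (Matrix.single i j c) = G (Matrix.single i j c)) (M : Matrix I I ℂ) :
    F M = G M := by
  have : hF.mk' F = hG.mk' G := by
    apply Matrix.ext_linearMap
    intro i j
    ext1
    exact h i j _
  exact LinearMap.congr_fun this M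

variable {A B A' B' C D : Type}

theorem relabel_single [DecidableEq A] [DecidableEq B] [DecidableEq A'] [DecidableEq B']
    (e : A ≃ A') (f : B ≃ B') (i j : A × B) (c : ℂ) :
    relabel e f (Matrix.single i j c) =
      Matrix.single (e i.1, f i.2) (e j.1, f j.2) c := by
  ext ⟨a, b⟩ ⟨a', b'⟩
  obtain ⟨i1, i2⟩ := i
  obtain ⟨j1, j2⟩ := j
  simp [relabel, Matrix.single_apply, Prod.ext_iff, Equiv.eq_symm_apply]

theorem sendToBob_single {X : Type} [DecidableEq X] [DecidableEq A] [DecidableEq B]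
    (i j : (X × A) × B) (c : ℂ) :
    sendToBob (Matrix.single i j c) =
      if i.1.1 = j.1.1 then Matrix.single (i.1.2, (i.1.1, i.2)) (j.1.2, (j.1.1, j.2)) c else 0 := by
  obtain ⟨⟨x, a⟩, b⟩ := i
  obtain ⟨⟨x', a'⟩, b'⟩ := j
  ext ⟨a1, x1, b1⟩ ⟨a2, x2, b2⟩
  simp only [sendToBob, Matrix.single_apply, Prod.ext_iff, Matrix.of_apply]
  split_ifs <;> simp_all

theorem sendToAlice_single {X : Type} [DecidableEq X] [DecidableEq A] [DecidableEq B]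
    (i j : A × (X × B)) (c : ℂ) :
    sendToAlice (Matrix.single i j c) =
      if i.2.1 = j.2.1 then Matrix.single ((i.2.1, i.1), i.2.2) ((j.2.1, j.1), j.2.2) c else 0 := by
  obtain ⟨a, ⟨x, b⟩⟩ := i
  obtain ⟨a', ⟨x', b'⟩⟩ := j
  ext ⟨⟨x1, a1⟩, b1⟩ ⟨⟨x2, a2⟩, b2⟩
  simp only [sendToAlice, Matrix.single_apply, Prod.ext_iff, Matrix.of_apply]
  split_ifs <;> simp_all

theorem isLinearMap_relabel (e : A ≃ A') (f : B ≃ B') : IsLinearMap ℂ (relabel e f) :=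
  ⟨fun _ _ => rfl, fun _ _ => rfl⟩

theorem isLinearMap_sendToBob {X : Type} [DecidableEq X] :
    IsLinearMap ℂ (sendToBob : BiOp (X × A) B → BiOp A (X × B)) := by
  constructor <;> intros <;> ext i j <;> simp only [sendToBob, Matrix.of_apply, Matrix.add_apply,
    Matrix.smul_apply] <;> split_ifs <;> simp

theorem isLinearMap_sendToAlice {X : Type} [DecidableEq X] :
    IsLinearMap ℂ (sendToAlice : BiOp A (X × B) → BiOp (X × A) B) := by
  constructor <;> intros <;> ext i j <;> simp only [sendToAlice, Matrix.of_apply, Matrix.add_apply,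
    Matrix.smul_apply] <;> split_ifs <;> simp

theorem isLinearMap_localUnitary [Fintype A] [DecidableEq A] [Fintype B] [DecidableEq B]
    (U : Matrix.unitaryGroup A ℂ) (V : Matrix.unitaryGroup B ℂ) :
    IsLinearMap ℂ (localUnitary U V) := by
  constructor <;> intros <;> simp [localUnitary, Matrix.mul_add, Matrix.add_mul]

theorem IsCLOCC.isLinearMap [Fintype A] [DecidableEq A] [Fintype B] [DecidableEq B]
    [Fintype A'] [DecidableEq A'] [Fintype B'] [DecidableEq B'] {Λ : BiOp A B → BiOp A' B'}
    (h : IsCLOCC Λ) : IsLinearMap ℂ Λ := by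
  induction h with
  | localUnitary U V => exact isLinearMap_localUnitary U V
  | relabel e f => exact isLinearMap_relabel e f
  | sendToBob => exact isLinearMap_sendToBob
  | sendToAlice => exact isLinearMap_sendToAlice
  | comp _ _ h1 h2 => exact (IsLinearMap.mk' _ h1 ∘ₗ IsLinearMap.mk' _ h2).isLinear

end Linearity

/-! ### What every CLOCC operation preserves: positivity, trace, identity, total dimension. -/

section Invariants

variable {A B A' B' : Type}

theorem kronecker_mul_conjTranspose_self [Fintype A] [DecidableEq A] [Fintype B] [DecidableEq B]
    (U : Matrix.unitaryGroup A ℂ) (V : Matrix.unitaryGroup B ℂ) :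
    ((U : Matrix A A ℂ) ⊗ₖ (V : Matrix B B ℂ)) * ((U : Matrix A A ℂ) ⊗ₖ (V : Matrix B B ℂ))ᴴ = 1 :=
  (Matrix.mem_unitaryGroup_iff.mp (Matrix.kronecker_mem_unitary U.2 V.2))

theorem conjTranspose_kronecker_mul_self [Fintype A] [DecidableEq A] [Fintype B] [DecidableEq B]
    (U : Matrix.unitaryGroup A ℂ) (V : Matrix.unitaryGroup B ℂ) :
    ((U : Matrix A A ℂ) ⊗ₖ (V : Matrix B B ℂ))ᴴ * ((U : Matrix A A ℂ) ⊗ₖ (V : Matrix B B ℂ)) = 1 :=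
  (Matrix.mem_unitaryGroup_iff'.mp (Matrix.kronecker_mem_unitary U.2 V.2))

/-- Dephasing is a sum of compressions `P M Pᴴ` by the diagonal projections onto the fibres of `t`.
Both directions of transmission are instances. -/
theorem posSemidef_blockDiag {I X : Type} [Fintype I] [Fintype X] [DecidableEq X]
    {M : Matrix I I ℂ} (hM : M.PosSemidef) (t : I → X) :
    (Matrix.of fun i j => if t i = t j then M i j else 0).PosSemidef := by
  classical
  have : (Matrix.of fun i j => if t i = t j then M i j else 0) =
      ∑ x, (Matrix.diagonal fun i => if t i = x then (1 : ℂ) else 0) * M *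
        (Matrix.diagonal fun i => if t i = x then (1 : ℂ) else 0)ᴴ := by
    ext i j
    simp only [Matrix.sum_apply, Matrix.diagonal_conjTranspose, Matrix.mul_diagonal,
      Matrix.diagonal_mul, Matrix.of_apply]
    simp only [Pi.star_apply, apply_ite (star : ℂ → ℂ), star_one, star_zero, ite_mul, one_mul,
      zero_mul, mul_ite, mul_one, mul_zero]
    rw [Finset.sum_eq_single (t j)]
    · simp
    · intro x _ hx
      simp [Ne.symm hx]
    · simp
  rw [this]
  exact Matrix.posSemidef_sum _ fun x _ => hM.mul_mul_conjTranspose_same _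

theorem sendToBob_posSemidef {X : Type} [Fintype X] [DecidableEq X] [Fintype A] [Fintype B]
    {ρ : BiOp (X × A) B} (h : ρ.PosSemidef) : (sendToBob ρ).PosSemidef :=
  posSemidef_blockDiag (h.submatrix fun i : A × (X × B) => ((i.2.1, i.1), i.2.2)) fun i => i.2.1

theorem sendToAlice_posSemidef {X : Type} [Fintype X] [DecidableEq X] [Fintype A] [Fintype B]
    {ρ : BiOp A (X × B)} (h : ρ.PosSemidef) : (sendToAlice ρ).PosSemidef :=
  posSemidef_blockDiag (h.submatrix fun i : (X × A) × B => (i.1.2, (i.1.1, i.2))) fun i => i.1.1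

variable [Fintype A] [DecidableEq A] [Fintype B] [DecidableEq B]
    [Fintype A'] [DecidableEq A'] [Fintype B'] [DecidableEq B'] {Λ : BiOp A B → BiOp A' B'}

theorem IsCLOCC.posSemidef (h : IsCLOCC Λ) : ∀ {ρ : BiOp A B}, ρ.PosSemidef → (Λ ρ).PosSemidef := by
  induction h with
  | localUnitary U V => exact fun hρ => hρ.mul_mul_conjTranspose_same _
  | relabel e f => exact fun hρ => hρ.submatrix (Prod.map e.symm f.symm)
  | sendToBob => exact fun hρ => sendToBob_posSemidef hρ
  | sendToAlice => exact fun hρ => sendToAlice_posSemidef hρ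
  | comp _ _ h1 h2 => exact fun hρ => h1 (h2 hρ)

theorem IsCLOCC.trace_eq (h : IsCLOCC Λ) : ∀ ρ : BiOp A B, (Λ ρ).trace = ρ.trace := by
  induction h with
  | localUnitary U V =>
    intro ρ
    rw [LocalInfo.localUnitary, Matrix.trace_mul_comm, ← Matrix.mul_assoc, conjTranspose_kronecker_mul_self,
      Matrix.one_mul]
  | relabel e f =>
    intro ρ
    exact Fintype.sum_equiv (Equiv.prodCongr e.symm f.symm) _ _ fun _ => rfl
  | @sendToBob X A B =>
    intro ρ
    refine Fintype.sum_equiv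
      (⟨fun i => ((i.2.1, i.1), i.2.2), fun i => (i.1.2, (i.1.1, i.2)), fun _ => rfl, fun _ => rfl⟩ :
        A × (X × B) ≃ (X × A) × B) _ _ fun _ => ?_
    simp [LocalInfo.sendToBob]
  | @sendToAlice X A B =>
    intro ρ
    refine Fintype.sum_equiv
      (⟨fun i => (i.1.2, (i.1.1, i.2)), fun i => ((i.2.1, i.1), i.2.2), fun _ => rfl, fun _ => rfl⟩ :
        (X × A) × B ≃ A × (X × B)) _ _ fun _ => ?_
    simp [LocalInfo.sendToAlice]
  | comp _ _ h1 h2 => exact fun ρ => (h1 _).trans (h2 ρ)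

/-- Unitality is what makes the maximally mixed state useless even when pure ancillas are available.
-/
theorem IsCLOCC.map_one (h : IsCLOCC Λ) : Λ 1 = 1 := by
  induction h with
  | localUnitary U V => simp [LocalInfo.localUnitary, kronecker_mul_conjTranspose_self]
  | relabel e f =>
    ext ⟨a, b⟩ ⟨a', b'⟩
    simp [LocalInfo.relabel, Matrix.one_apply]
  | sendToBob =>
    ext ⟨a, x, b⟩ ⟨a', x', b'⟩
    simp only [LocalInfo.sendToBob, Matrix.one_apply, Matrix.of_apply, Prod.ext_iff]
    split_ifs <;> simp_all
  | sendToAlice =>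
    ext ⟨⟨x, a⟩, b⟩ ⟨⟨x', a'⟩, b'⟩
    simp only [LocalInfo.sendToAlice, Matrix.one_apply, Matrix.of_apply, Prod.ext_iff]
    split_ifs <;> simp_all
  | comp _ _ h1 h2 => simp [h1, h2]

theorem IsCLOCC.isState (h : IsCLOCC Λ) {ρ : BiOp A B} (hρ : IsState ρ) : IsState (Λ ρ) :=
  ⟨h.posSemidef hρ.1, (h.trace_eq ρ).trans hρ.2⟩

/-- Systems only move between the parties. Hence the dimension term of the information is a constant
of the protocol and only the entropy matters. -/
theorem IsCLOCC.card_eq (h : IsCLOCC Λ) :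
    Fintype.card A * Fintype.card B = Fintype.card A' * Fintype.card B' := by
  induction h with
  | localUnitary U V => rfl
  | relabel e f => rw [Fintype.card_congr e, Fintype.card_congr f]
  | sendToBob => simp only [Fintype.card_prod]; ring
  | sendToAlice => simp only [Fintype.card_prod]; ring
  | comp _ _ h1 h2 => exact h2.trans h1

end Invariants

/-! ### Reachability, tensor products and tensor powers. -/

/-- `ρ` can be transformed into `σ` by a closed LOCC operation. -/
def Reach {A B A' B' : Type} [Fintype A] [DecidableEq A] [Fintype B] [DecidableEq B]
    [Fintype A'] [DecidableEq A'] [Fintype B'] [DecidableEq B']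
    (ρ : BiOp A B) (σ : BiOp A' B') : Prop :=
  ∃ Λ : BiOp A B → BiOp A' B', IsCLOCC Λ ∧ Λ ρ = σ

/-- The tensor product of two bipartite operators, grouped by parties. -/
def tensor {A B C D : Type} (ρ : BiOp A B) (σ : BiOp C D) : BiOp (A × C) (B × D) :=
  Matrix.of fun i j => ρ (i.1.1, i.2.1) (j.1.1, j.2.1) * σ (i.1.2, i.2.2) (j.1.2, j.2.2)

/-- The operator that is diagonal in the standard product basis with diagonal `P`. -/
def diagOp {A B : Type} [DecidableEq A] [DecidableEq B] (P : A × B → ℝ) : BiOp A B :=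
  Matrix.diagonal fun i => (P i : ℂ)

section Tensor

variable {A B C D : Type}

theorem isLinearMap_tensor_left (τ : BiOp C D) :
    IsLinearMap ℂ (fun ρ : BiOp A B => tensor ρ τ) :=
  ⟨fun _ _ => by ext; simp [tensor, add_mul], fun _ _ => by ext; simp [tensor, mul_assoc]⟩

theorem isLinearMap_tensor_right (ρ : BiOp A B) :
    IsLinearMap ℂ (fun τ : BiOp C D => tensor ρ τ) :=
  ⟨fun _ _ => by ext; simp [tensor, mul_add], fun _ _ => by ext; simp [tensor, mul_left_comm]⟩

theorem tensor_eq_submatrix (ρ : BiOp A B) (τ : BiOp C D) :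
    tensor ρ τ = (ρ ⊗ₖ τ).submatrix (Equiv.prodProdProdComm A C B D)
      (Equiv.prodProdProdComm A C B D) := rfl

end Tensor

section Reach

variable {A B A' B' A'' B'' C D C' D' : Type} [Fintype A] [DecidableEq A] [Fintype B] [DecidableEq B]
    [Fintype A'] [DecidableEq A'] [Fintype B'] [DecidableEq B']
    [Fintype A''] [DecidableEq A''] [Fintype B''] [DecidableEq B'']
    [Fintype C] [DecidableEq C] [Fintype D] [DecidableEq D]
    [Fintype C'] [DecidableEq C'] [Fintype D'] [DecidableEq D']

theorem Reach.trans {ρ : BiOp A B} {σ : BiOp A' B'} {τ : BiOp A'' B''}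
    (h1 : Reach ρ σ) (h2 : Reach σ τ) : Reach ρ τ := by
  obtain ⟨Λ, h, rfl⟩ := h1
  obtain ⟨Λ', h', rfl⟩ := h2
  exact ⟨_, h'.comp h, rfl⟩

theorem reach_relabel (e : A ≃ A') (f : B ≃ B') (ρ : BiOp A B) : Reach ρ (relabel e f ρ) :=
  ⟨_, IsCLOCC.relabel e f, rfl⟩

theorem Reach.isState {ρ : BiOp A B} {σ : BiOp A' B'} (h : Reach ρ σ) (hρ : IsState ρ) :
    IsState σ := by
  obtain ⟨Λ, h, rfl⟩ := h
  exact h.isState hρ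

theorem Reach.card_eq {ρ : BiOp A B} {σ : BiOp A' B'} (h : Reach ρ σ) :
    Fintype.card A * Fintype.card B = Fintype.card A' * Fintype.card B' := by
  obtain ⟨Λ, h, rfl⟩ := h
  exact h.card_eq

/-- A protocol can be run beside spectators `C` and `D`. Each generator extends, after regrouping of
the tensor factors. -/
theorem IsCLOCC.exists_tensor {Λ : BiOp A B → BiOp A' B'} (h : IsCLOCC Λ) (C D : Type)
    [Fintype C] [DecidableEq C] [Fintype D] [DecidableEq D] :
    ∃ Λ' : BiOp (A × C) (B × D) → BiOp (A' × C) (B' × D), IsCLOCC Λ' ∧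
      ∀ (ρ : BiOp A B) (τ : BiOp C D), Λ' (tensor ρ τ) = tensor (Λ ρ) τ := by
  induction h with
  | @localUnitary A B _ _ _ _ U V =>
    refine ⟨_, IsCLOCC.localUnitary
      ⟨(U : Matrix A A ℂ) ⊗ₖ (1 : Matrix C C ℂ), Matrix.kronecker_mem_unitary U.2 (one_mem _)⟩
      ⟨(V : Matrix B B ℂ) ⊗ₖ (1 : Matrix D D ℂ), Matrix.kronecker_mem_unitary V.2 (one_mem _)⟩, ?_⟩
    intro ρ τ
    have hK : ((U : Matrix A A ℂ) ⊗ₖ (1 : Matrix C C ℂ)) ⊗ₖ ((V : Matrix B B ℂ) ⊗ₖ (1 : Matrix D D ℂ)) =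
        (((U : Matrix A A ℂ) ⊗ₖ (V : Matrix B B ℂ)) ⊗ₖ (1 : Matrix (C × D) (C × D) ℂ)).submatrix
          (Equiv.prodProdProdComm A C B D) (Equiv.prodProdProdComm A C B D) := by
      rw [← Matrix.one_kronecker_one]
      ext ⟨⟨a, c⟩, ⟨b, d⟩⟩ ⟨⟨a', c'⟩, ⟨b', d'⟩⟩
      simp only [Matrix.kroneckerMap_apply, Matrix.submatrix_apply, Equiv.prodProdProdComm_apply]
      ring
    simp only [LocalInfo.localUnitary]
    rw [hK, tensor_eq_submatrix, tensor_eq_submatrix, Matrix.conjTranspose_submatrix,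
      Matrix.submatrix_mul_equiv, Matrix.submatrix_mul_equiv, Matrix.conjTranspose_kronecker,
      ← Matrix.mul_kronecker_mul, ← Matrix.mul_kronecker_mul]
    simp
  | relabel e f =>
    exact ⟨_, IsCLOCC.relabel (e.prodCongr (Equiv.refl C)) (f.prodCongr (Equiv.refl D)),
      fun ρ τ => rfl⟩
  | @sendToBob X A B =>
    refine ⟨_, (IsCLOCC.relabel (Equiv.refl _) (Equiv.prodAssoc X B D).symm).comp
      (IsCLOCC.sendToBob.comp
        (IsCLOCC.relabel (Equiv.prodAssoc X A C) (Equiv.refl (B × D)))), fun ρ τ => ?_⟩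
    ext ⟨⟨a, c⟩, ⟨⟨x, b⟩, d⟩⟩ ⟨⟨a', c'⟩, ⟨⟨x', b'⟩, d'⟩⟩
    simp [LocalInfo.relabel, LocalInfo.sendToBob, tensor]
  | @sendToAlice X A B =>
    refine ⟨_, (IsCLOCC.relabel (Equiv.prodAssoc X A C).symm (Equiv.refl _)).comp
      (IsCLOCC.sendToAlice.comp
        (IsCLOCC.relabel (Equiv.refl (A × C)) (Equiv.prodAssoc X B D))), fun ρ τ => ?_⟩
    ext ⟨⟨⟨x, a⟩, c⟩, ⟨b, d⟩⟩ ⟨⟨⟨x', a'⟩, c'⟩, ⟨b', d'⟩⟩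
    simp [LocalInfo.relabel, LocalInfo.sendToAlice, tensor]
  | comp _ _ h1 h2 =>
    obtain ⟨Λ1, hΛ1, e1⟩ := h1
    obtain ⟨Λ2, hΛ2, e2⟩ := h2
    exact ⟨_, hΛ1.comp hΛ2, fun ρ τ => by simp [e1, e2]⟩

theorem Reach.tensor_left {ρ : BiOp A B} {ρ' : BiOp A' B'} (h : Reach ρ ρ') (τ : BiOp C D) :
    Reach (tensor ρ τ) (tensor ρ' τ) := by
  obtain ⟨Λ, hΛ, rfl⟩ := h
  obtain ⟨Λ', hΛ', e⟩ := hΛ.exists_tensor C D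
  exact ⟨Λ', hΛ', e ρ τ⟩

theorem reach_tensor_comm (ρ : BiOp A B) (τ : BiOp C D) : Reach (tensor ρ τ) (tensor τ ρ) := by
  convert reach_relabel (Equiv.prodComm A C) (Equiv.prodComm B D) (tensor ρ τ) using 1
  ext ⟨⟨a, c⟩, ⟨b, d⟩⟩ ⟨⟨a', c'⟩, ⟨b', d'⟩⟩
  simp [relabel, tensor, mul_comm]

theorem Reach.tensor {ρ : BiOp A B} {ρ' : BiOp A' B'} {τ : BiOp C D} {τ' : BiOp C' D'}
    (h : Reach ρ ρ') (h' : Reach τ τ') : Reach (tensor ρ τ) (tensor ρ' τ') :=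
  (h.tensor_left τ).trans <| (reach_tensor_comm _ _).trans <|
    (h'.tensor_left ρ').trans (reach_tensor_comm _ _)

theorem reach_tensorPow_add (ρ : BiOp A B) (m n : ℕ) :
    Reach (tensorPow (m + n) ρ) (LocalInfo.tensor (tensorPow m ρ) (tensorPow n ρ)) := by
  convert reach_relabel (Fin.appendEquiv m n).symm (Fin.appendEquiv m n).symm
    (tensorPow (m + n) ρ) using 1
  ext ⟨⟨a, c⟩, ⟨b, d⟩⟩ ⟨⟨a', c'⟩, ⟨b', d'⟩⟩
  simp [relabel, LocalInfo.tensor, tensorPow, Fin.prod_univ_add, Fin.appendEquiv]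

theorem reach_tensorPow_add' (ρ : BiOp A B) (m n : ℕ) :
    Reach (LocalInfo.tensor (tensorPow m ρ) (tensorPow n ρ)) (tensorPow (m + n) ρ) := by
  convert reach_relabel (Fin.appendEquiv m n) (Fin.appendEquiv m n)
    (LocalInfo.tensor (tensorPow m ρ) (tensorPow n ρ)) using 1
  ext ⟨a, b⟩ ⟨a', b'⟩
  simp [relabel, LocalInfo.tensor, tensorPow, Fin.prod_univ_add, Fin.appendEquiv]

theorem reach_tensorPow_one (ρ : BiOp A B) : Reach ρ (tensorPow 1 ρ) := by
  convert reach_relabel (Equiv.funUnique (Fin 1) A).symm (Equiv.funUnique (Fin 1) B).symm ρ using 1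
  ext ⟨a, b⟩ ⟨a', b'⟩
  simp [relabel, tensorPow]

theorem reach_tensorPow_one' (ρ : BiOp A B) : Reach (tensorPow 1 ρ) ρ := by
  convert reach_relabel (Equiv.funUnique (Fin 1) A) (Equiv.funUnique (Fin 1) B)
    (tensorPow 1 ρ) using 1
  ext ⟨a, b⟩ ⟨a', b'⟩
  simp [relabel, tensorPow]

theorem reach_tensorPow_zero (ρ : BiOp A B) (σ : BiOp A' B') :
    Reach (tensorPow 0 ρ) (tensorPow 0 σ) := by
  convert reach_relabel (Equiv.ofUnique (Fin 0 → A) (Fin 0 → A'))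
    (Equiv.ofUnique (Fin 0 → B) (Fin 0 → B')) (tensorPow 0 ρ) using 1
  ext ⟨a, b⟩ ⟨a', b'⟩
  simp [relabel, tensorPow]

theorem Reach.tensorPow {ρ : BiOp A B} {σ : BiOp A' B'} (h : Reach ρ σ) (n : ℕ) :
    Reach (tensorPow n ρ) (tensorPow n σ) := by
  induction n with
  | zero => exact reach_tensorPow_zero ρ σ
  | succ n ih =>
    exact (reach_tensorPow_add ρ n 1).trans <| (ih.tensor <| (reach_tensorPow_one' ρ).trans <|
      h.trans (reach_tensorPow_one σ)).trans (reach_tensorPow_add' σ n 1)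

end Reach

/-! ### Local spaces enlarged by blank basis states. -/

section Embed

/-- The matrix of the linear map that sends the basis vector `i` to the basis vector `h i`. -/
def inclusion {I K : Type} [DecidableEq K] (h : I → K) : Matrix K I ℂ :=
  Matrix.of fun k i => if k = h i then 1 else 0

/-- The operator `ρ` carried to larger local spaces along maps of the basis labels. -/
def embed {A B A' B' : Type} [Fintype A] [Fintype B] [DecidableEq A'] [DecidableEq B']
    (f : A → A') (g : B → B') (ρ : BiOp A B) : BiOp A' B' :=
  (inclusion f ⊗ₖ inclusion g) * ρ * (inclusion f ⊗ₖ inclusion g)ᴴ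

theorem inclusion_conjTranspose_mul_self {I K : Type} [DecidableEq I] [DecidableEq K] [Fintype K]
    {h : I → K} (hh : Function.Injective h) : (inclusion h)ᴴ * inclusion h = 1 := by
  ext i j
  simp [inclusion, Matrix.mul_apply, Matrix.one_apply, hh.eq_iff, eq_comm]

theorem inclusion_mul {I K L : Type} [DecidableEq K] [Fintype K] [DecidableEq L]
    (h : I → K) (h' : K → L) : inclusion h' * inclusion h = inclusion (h' ∘ h) := by
  ext i j
  simp [inclusion, Matrix.mul_apply]

section

variable {A B A' B' A'' B'' : Type} [Fintype A] [Fintype B] [DecidableEq A'] [DecidableEq B']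
  (f : A → A') (g : B → B')

theorem isLinearMap_embed : IsLinearMap ℂ (embed f g) := by
  constructor <;> intros <;> simp [embed, Matrix.mul_add, Matrix.add_mul]

theorem embed_apply (ρ : BiOp A B) (i j : A' × B') :
    embed f g ρ i j = ∑ k, ∑ l, if i = Prod.map f g k ∧ j = Prod.map f g l then ρ k l else 0 := by
  rw [embed, Matrix.mul_apply, Finset.sum_comm]
  refine Finset.sum_congr rfl fun k _ => ?_
  rw [Matrix.mul_apply, Finset.sum_mul]
  refine Finset.sum_congr rfl fun l _ => ?_
  obtain ⟨i1, i2⟩ := i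
  obtain ⟨j1, j2⟩ := j
  simp only [inclusion, Matrix.conjTranspose_apply, Matrix.kroneckerMap_apply, Matrix.of_apply,
    Prod.map, Prod.ext_iff]
  split_ifs <;> simp_all

theorem embed_single [DecidableEq A] [DecidableEq B] (i j : A × B) (c : ℂ) :
    embed f g (Matrix.single i j c) =
      Matrix.single (f i.1, g i.2) (f j.1, g j.2) c := by
  ext ⟨a, b⟩ ⟨a', b'⟩
  rw [embed_apply, Finset.sum_eq_single i, Finset.sum_eq_single j]
  · obtain ⟨i1, i2⟩ := i
    obtain ⟨j1, j2⟩ := j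
    simp [Matrix.single_apply, eq_comm]
  · intro l _ hl
    simp [Ne.symm hl]
  · simp
  · intro k _ hk
    simp [Ne.symm hk]
  · simp

theorem embed_embed [Fintype A'] [Fintype B'] [DecidableEq A''] [DecidableEq B'']
    (f' : A' → A'') (g' : B' → B'') (ρ : BiOp A B) :
    embed f' g' (embed f g ρ) = embed (f' ∘ f) (g' ∘ g) ρ := by
  simp only [embed, ← inclusion_mul, Matrix.mul_kronecker_mul, Matrix.conjTranspose_mul,
    Matrix.mul_assoc]

end

section

variable {A B A' B' A'' B'' : Type} [Fintype A] [DecidableEq A] [Fintype B] [DecidableEq B]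
    [Fintype A'] [DecidableEq A'] [Fintype B'] [DecidableEq B']
    [Fintype A''] [DecidableEq A''] [Fintype B''] [DecidableEq B'']

theorem relabel_embed (e : A' ≃ A'') (e' : B' ≃ B'') (f : A → A') (g : B → B') (ρ : BiOp A B) :
    relabel e e' (embed f g ρ) = embed (e ∘ f) (e' ∘ g) ρ := by
  refine isLinearMap_ext_single (F := fun ρ => relabel e e' (embed f g ρ))
    (IsLinearMap.mk' _ (isLinearMap_relabel e e') ∘ₗ
      IsLinearMap.mk' _ (isLinearMap_embed f g)).isLinear (isLinearMap_embed _ _) ?_ ρ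
  intro i j c
  simp [embed_single, relabel_single]

theorem embed_relabel (e : A ≃ A') (e' : B ≃ B') (f : A' → A'') (g : B' → B'') (ρ : BiOp A B) :
    embed f g (relabel e e' ρ) = embed (f ∘ e) (g ∘ e') ρ := by
  refine isLinearMap_ext_single (F := fun ρ => embed f g (relabel e e' ρ))
    (IsLinearMap.mk' _ (isLinearMap_embed f g) ∘ₗ
      IsLinearMap.mk' _ (isLinearMap_relabel e e')).isLinear (isLinearMap_embed _ _) ?_ ρ
  intro i j c
  simp [embed_single, relabel_single]

/-- The complements of the two ranges have equal cardinality, so the bijection between the ranges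
extends. Such permutations of basis labels are free operations, and this is how every register
manipulation below is built. -/
theorem exists_equiv_extending {I K L : Type} [Fintype K] [Fintype L] {f : I → K} {g : I → L}
    (hf : Function.Injective f) (hg : Function.Injective g)
    (h : Fintype.card K = Fintype.card L) : ∃ e : K ≃ L, ∀ i, e (f i) = g i := by
  classical
  let e₀ := Fintype.equivOfCardEq h
  let ef := Equiv.ofInjective (e₀ ∘ f) (e₀.injective.comp hf)
  let eg := Equiv.ofInjective g hg
  let t : {x // x ∈ Set.range (e₀ ∘ f)} ≃ {x // x ∈ Set.range g} := ef.symm.trans eg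
  refine ⟨e₀.trans t.extendSubtype, fun i => ?_⟩
  have hi : e₀ (f i) ∈ Set.range (e₀ ∘ f) := ⟨i, rfl⟩
  rw [Equiv.trans_apply, Equiv.extendSubtype_apply_of_mem t _ hi]
  have : ef.symm ⟨e₀ (f i), hi⟩ = i := by
    rw [Equiv.symm_apply_eq]
    rfl
  simp [t, this, eg]

/-- Only the dimensions of the enlarged spaces matter, not the place where the state sits in them.
-/
theorem reach_embed_of_card_eq {f : A → A'} {g : B → B'} {f' : A → A''} {g' : B → B''}
    (hf : Function.Injective f) (hg : Function.Injective g) (hf' : Function.Injective f')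
    (hg' : Function.Injective g') (hA : Fintype.card A' = Fintype.card A'')
    (hB : Fintype.card B' = Fintype.card B'') (ρ : BiOp A B) :
    Reach (embed f g ρ) (embed f' g' ρ) := by
  obtain ⟨e, he⟩ := exists_equiv_extending hf hf' hA
  obtain ⟨e', he'⟩ := exists_equiv_extending hg hg' hB
  convert reach_relabel e e' (embed f g ρ) using 1
  rw [relabel_embed]
  congr 1
  · exact funext fun i => (he i).symm
  · exact funext fun i => (he' i).symm

/-- This links the two pictures of a blank ancilla: a tensor factor in a basis state, and unused
dimensions of a larger space. -/
theorem tensor_single_embed (a : A') (b : B') (τ : BiOp A B) :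
    tensor (Matrix.single (a, b) (a, b) 1) τ = embed (Prod.mk a) (Prod.mk b) τ := by
  refine isLinearMap_ext_single (isLinearMap_tensor_right _) (isLinearMap_embed _ _) ?_ τ
  rintro ⟨i1, i2⟩ ⟨j1, j2⟩ c
  rw [embed_single]
  ext ⟨⟨a1, a2⟩, ⟨b1, b2⟩⟩ ⟨⟨a3, a4⟩, ⟨b3, b4⟩⟩
  simp only [tensor, Matrix.of_apply, Matrix.single_apply, Prod.ext_iff, ite_mul, one_mul, zero_mul,
    ← ite_and]
  exact if_congr (by tauto) rfl rfl

/-- With the isometry F = `inclusion f`, take U on the range of F and the identity on its orthogonal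
complement: `F U Fᴴ + (1 - F Fᴴ)`. -/
theorem exists_unitary_extending {I K : Type} [Fintype I] [DecidableEq I] [Fintype K]
    [DecidableEq K] {f : I → K} (hf : Function.Injective f) (U : Matrix.unitaryGroup I ℂ) :
    ∃ W : Matrix.unitaryGroup K ℂ,
      (W : Matrix K K ℂ) * inclusion f = inclusion f * (U : Matrix I I ℂ) := by
  obtain ⟨U, hU⟩ := U
  set F : Matrix K I ℂ := inclusion f
  have hF : Fᴴ * F = 1 := inclusion_conjTranspose_mul_self hf
  have hU : U * Uᴴ = 1 := Matrix.mem_unitaryGroup_iff.mp hU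
  have hF' : ∀ M : Matrix I K ℂ, Fᴴ * (F * M) = M := fun M => by
    rw [← Matrix.mul_assoc, hF, Matrix.one_mul]
  have hU' : ∀ M : Matrix I K ℂ, U * (Uᴴ * M) = M := fun M => by
    rw [← Matrix.mul_assoc, hU, Matrix.one_mul]
  refine ⟨⟨F * U * Fᴴ + (1 - F * Fᴴ), Matrix.mem_unitaryGroup_iff.mpr ?_⟩, ?_⟩
  · simp only [Matrix.star_eq_conjTranspose, Matrix.conjTranspose_add, Matrix.conjTranspose_sub,
      Matrix.conjTranspose_mul, Matrix.conjTranspose_conjTranspose, Matrix.conjTranspose_one,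
      Matrix.mul_add, Matrix.add_mul, Matrix.mul_sub, Matrix.sub_mul, Matrix.mul_one,
      Matrix.one_mul, Matrix.mul_assoc, hF', hU']
    abel
  · simp only [Matrix.add_mul, Matrix.sub_mul, Matrix.one_mul, Matrix.mul_assoc, hF, Matrix.mul_one]
    abel

theorem exists_localUnitary_embed {f : A → A'} {g : B → B'} (hf : Function.Injective f)
    (hg : Function.Injective g) (U : Matrix.unitaryGroup A ℂ) (V : Matrix.unitaryGroup B ℂ) :
    ∃ (U' : Matrix.unitaryGroup A' ℂ) (V' : Matrix.unitaryGroup B' ℂ), ∀ ρ : BiOp A B,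
      localUnitary U' V' (embed f g ρ) = embed f g (localUnitary U V ρ) := by
  obtain ⟨U', hU⟩ := exists_unitary_extending hf U
  obtain ⟨V', hV⟩ := exists_unitary_extending hg V
  refine ⟨U', V', fun ρ => ?_⟩
  have key : ((U' : Matrix A' A' ℂ) ⊗ₖ (V' : Matrix B' B' ℂ)) * (inclusion f ⊗ₖ inclusion g) =
      (inclusion f ⊗ₖ inclusion g) * ((U : Matrix A A ℂ) ⊗ₖ (V : Matrix B B ℂ)) := by
    rw [← Matrix.mul_kronecker_mul, hU, hV, Matrix.mul_kronecker_mul]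
  have e1 : localUnitary U' V' (embed f g ρ) =
      (((U' : Matrix A' A' ℂ) ⊗ₖ (V' : Matrix B' B' ℂ)) * (inclusion f ⊗ₖ inclusion g)) * ρ *
      (((U' : Matrix A' A' ℂ) ⊗ₖ (V' : Matrix B' B' ℂ)) * (inclusion f ⊗ₖ inclusion g))ᴴ := by
    simp only [localUnitary, embed, Matrix.conjTranspose_mul, Matrix.mul_assoc]
  rw [e1, key]
  simp only [localUnitary, embed, Matrix.conjTranspose_mul, Matrix.mul_assoc]

theorem exists_injective_of_card_le {I K : Type} [Fintype I] [Fintype K]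
    (h : Fintype.card I ≤ Fintype.card K) : ∃ f : I → K, Function.Injective f := by
  obtain ⟨f⟩ := Function.Embedding.nonempty_of_card_le h
  exact ⟨f, f.injective⟩

end

end Embed

/-! ### Simulation of CLOCC operations with both local dimensions fixed. -/

section Simulation

/-- Alice's subsystem can be transmitted using her blank basis states, in such a way that both
parties keep their total dimensions: Bob copies the contents of the register into his own blank
states and returns the register. -/
theorem exists_simulation_sendToBob {X A B E F Y R : Type} [Fintype X] [DecidableEq X]
    [Fintype A] [DecidableEq A] [Fintype B] [DecidableEq B] [Fintype E] [DecidableEq E]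
    [Fintype F] [DecidableEq F] [Fintype Y] [DecidableEq Y] [Fintype R] [DecidableEq R] [Nonempty Y]
    (hE : Fintype.card E = Fintype.card Y * Fintype.card R)
    (hX : Fintype.card X ≤ Fintype.card Y) (hA : Fintype.card A ≤ Fintype.card R)
    (hF : Fintype.card (X × B) ≤ Fintype.card F)
    {f : X × A → E} {g : B → F} (hf : Function.Injective f) (hg : Function.Injective g) :
    ∃ (f' : A → E) (g' : X × B → F), Function.Injective f' ∧ Function.Injective g' ∧
      ∃ Λ : BiOp E F → BiOp E F, IsCLOCC Λ ∧
        ∀ ρ, Λ (embed f g ρ) = embed f' g' (sendToBob ρ) := by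
  obtain ⟨ι, hι⟩ := exists_injective_of_card_le hX
  obtain ⟨κ, hκ⟩ := exists_injective_of_card_le hA
  obtain ⟨g', hg'⟩ := exists_injective_of_card_le hF
  obtain ⟨y₀⟩ := ‹Nonempty Y›
  have hE' : Fintype.card E = Fintype.card (Y × R) := by rw [hE, Fintype.card_prod]
  -- Alice's space is split as `Y × R`, with `x` stored in the factor `Y` to be sent and `a` in the
  -- factor `R` that stays.
  obtain ⟨e₁, he₁⟩ := exists_equiv_extending hf (hι.prodMap hκ) hE'
  -- Bob's permutation absorbs `x` into his own space and resets the register to `y₀`. The register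
  -- that travels back is therefore constant and its second dephasing does nothing.
  obtain ⟨e₂, he₂⟩ := exists_equiv_extending (hι.prodMap hg)
    (g := fun x => (y₀, g' x)) (fun _ _ h => hg' (Prod.ext_iff.mp h).2)
    (rfl : Fintype.card (Y × F) = Fintype.card (Y × F))
  let e₃ := Fintype.equivOfCardEq hE'.symm
  have c1 := IsCLOCC.relabel e₁ (Equiv.refl F)
  have c2 := IsCLOCC.sendToBob (X := Y) (A := R) (B := F)
  have c3 := IsCLOCC.relabel (Equiv.refl R) e₂
  have c4 := IsCLOCC.sendToAlice (X := Y) (A := R) (B := F)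
  have c5 := IsCLOCC.relabel e₃ (Equiv.refl F)
  have c := c5.comp (c4.comp (c3.comp (c2.comp c1)))
  refine ⟨fun a => e₃ (y₀, κ a), g', fun _ _ h => ?_, hg', _, c, fun ρ => ?_⟩
  · exact hκ (Prod.ext_iff.mp (e₃.injective h)).2
  · refine isLinearMap_ext_single (F := fun ρ => _)
      (IsLinearMap.mk' _ c.isLinearMap ∘ₗ IsLinearMap.mk' _ (isLinearMap_embed f g)).isLinear
      (IsLinearMap.mk' _ (isLinearMap_embed _ g') ∘ₗ
        IsLinearMap.mk' _ isLinearMap_sendToBob).isLinear ?_ ρ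
    rintro ⟨⟨x, a⟩, b⟩ ⟨⟨x', a'⟩, b'⟩ c
    have h1 := fun x b => he₂ (x, b)
    simp only [Prod.map_apply] at h1
    by_cases hx : x = x'
    · subst hx
      simp [embed_single, relabel_single, sendToBob_single, sendToAlice_single, he₁, h1]
    -- Coherences between different `x` are destroyed by the first dephasing, since `ι` is
    -- injective; both sides vanish.
    · simp [embed_single, relabel_single, sendToBob_single, he₁, hx, hι.eq_iff,
        (isLinearMap_relabel _ _).map_zero, isLinearMap_sendToAlice.map_zero,
        (isLinearMap_embed _ _).map_zero]

/-- The same device with the parties exchanged. -/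
theorem exists_simulation_sendToAlice {X A B E F Y R : Type} [Fintype X] [DecidableEq X]
    [Fintype A] [DecidableEq A] [Fintype B] [DecidableEq B] [Fintype E] [DecidableEq E]
    [Fintype F] [DecidableEq F] [Fintype Y] [DecidableEq Y] [Fintype R] [DecidableEq R] [Nonempty Y]
    (hF : Fintype.card F = Fintype.card Y * Fintype.card R)
    (hX : Fintype.card X ≤ Fintype.card Y) (hB : Fintype.card B ≤ Fintype.card R)
    (hE : Fintype.card (X × A) ≤ Fintype.card E)
    {f : A → E} {g : X × B → F} (hf : Function.Injective f) (hg : Function.Injective g) :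
    ∃ (f' : X × A → E) (g' : B → F), Function.Injective f' ∧ Function.Injective g' ∧
      ∃ Λ : BiOp E F → BiOp E F, IsCLOCC Λ ∧
        ∀ ρ, Λ (embed f g ρ) = embed f' g' (sendToAlice ρ) := by
  obtain ⟨ι, hι⟩ := exists_injective_of_card_le hX
  obtain ⟨κ, hκ⟩ := exists_injective_of_card_le hB
  obtain ⟨f', hf'⟩ := exists_injective_of_card_le hE
  obtain ⟨y₀⟩ := ‹Nonempty Y›
  have hF' : Fintype.card F = Fintype.card (Y × R) := by rw [hF, Fintype.card_prod]
  obtain ⟨e₁, he₁⟩ := exists_equiv_extending hg (hι.prodMap hκ) hF'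
  obtain ⟨e₂, he₂⟩ := exists_equiv_extending (hι.prodMap hf)
    (g := fun x => (y₀, f' x)) (fun _ _ h => hf' (Prod.ext_iff.mp h).2)
    (rfl : Fintype.card (Y × E) = Fintype.card (Y × E))
  let e₃ := Fintype.equivOfCardEq hF'.symm
  have c1 := IsCLOCC.relabel (Equiv.refl E) e₁
  have c2 := IsCLOCC.sendToAlice (X := Y) (A := E) (B := R)
  have c3 := IsCLOCC.relabel e₂ (Equiv.refl R)
  have c4 := IsCLOCC.sendToBob (X := Y) (A := E) (B := R)
  have c5 := IsCLOCC.relabel (Equiv.refl E) e₃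
  have c := c5.comp (c4.comp (c3.comp (c2.comp c1)))
  refine ⟨f', fun a => e₃ (y₀, κ a), hf', fun _ _ h => ?_, _, c, fun ρ => ?_⟩
  · exact hκ (Prod.ext_iff.mp (e₃.injective h)).2
  · refine isLinearMap_ext_single (F := fun ρ => _)
      (IsLinearMap.mk' _ c.isLinearMap ∘ₗ IsLinearMap.mk' _ (isLinearMap_embed f g)).isLinear
      (IsLinearMap.mk' _ (isLinearMap_embed f' _) ∘ₗ
        IsLinearMap.mk' _ isLinearMap_sendToAlice).isLinear ?_ ρ
    rintro ⟨a, ⟨x, b⟩⟩ ⟨a', ⟨x', b'⟩⟩ c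
    have h1 := fun x b => he₂ (x, b)
    simp only [Prod.map_apply] at h1
    by_cases hx : x = x'
    · subst hx
      simp [embed_single, relabel_single, sendToBob_single, sendToAlice_single, he₁, h1]
    · simp [embed_single, relabel_single, sendToAlice_single, he₁, hx, hι.eq_iff,
        (isLinearMap_relabel _ _).map_zero, isLinearMap_sendToBob.map_zero,
        (isLinearMap_embed _ _).map_zero]

/-- The dimensions `u * D ^ M` and `v * D ^ M` are those of a system of dimension `u` or `v` with a
register of `M` systems of dimension `D`. The threshold depends only on the protocol and serves all
embeddings `f`, `g`, so that in a composition the second protocol can start from whatever embedding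
the first one leaves; the thresholds combine by a maximum. -/
theorem IsCLOCC.exists_simulation {A B A' B' : Type} [Fintype A] [DecidableEq A] [Fintype B]
    [DecidableEq B] [Fintype A'] [DecidableEq A'] [Fintype B'] [DecidableEq B']
    {Λ : BiOp A B → BiOp A' B'} (h : IsCLOCC Λ) {D : ℕ} (hD : 2 ≤ D) :
    ∃ M₀ : ℕ, ∀ M ≥ M₀, ∀ (E F : Type) [Fintype E] [DecidableEq E] [Fintype F] [DecidableEq F]
      (u v : ℕ), 0 < u → 0 < v → Fintype.card E = u * D ^ M → Fintype.card F = v * D ^ M →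
      ∀ (f : A → E) (g : B → F), Function.Injective f → Function.Injective g →
      ∃ (f' : A' → E) (g' : B' → F), Function.Injective f' ∧ Function.Injective g' ∧
        ∃ Λ' : BiOp E F → BiOp E F, IsCLOCC Λ' ∧
          ∀ ρ, Λ' (embed f g ρ) = embed f' g' (Λ ρ) := by
  have hpow : ∀ {n k : ℕ}, n ≤ k → n ≤ D ^ k := fun h =>
    h.trans (Nat.lt_pow_self hD).le
  have hpos : ∀ k : ℕ, 0 < D ^ k := fun k => pow_pos (by omega) k
  induction h with
  | localUnitary U V =>
    refine ⟨0, fun M _ E F _ _ _ _ u v _ _ _ _ f g hf hg => ?_⟩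
    obtain ⟨U', V', h⟩ := exists_localUnitary_embed hf hg U V
    exact ⟨f, g, hf, hg, _, IsCLOCC.localUnitary U' V', h⟩
  | relabel e e' =>
    refine ⟨0, fun M _ E F _ _ _ _ u v _ _ _ _ f g hf hg => ?_⟩
    refine ⟨f ∘ e.symm, g ∘ e'.symm, hf.comp e.symm.injective, hg.comp e'.symm.injective, _,
      IsCLOCC.relabel (Equiv.refl E) (Equiv.refl F), fun ρ => ?_⟩
    rw [relabel_embed, embed_relabel]
    congr 1 <;> funext <;> simp
  | @sendToBob X A B =>
    refine ⟨Fintype.card X + Fintype.card A + Fintype.card (X × B),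
      fun M hM E F _ _ _ _ u v hu hv hE hF f g hf hg => ?_⟩
    -- A factor of dimension D^|X| ≥ |X| is the transmitted register; the remaining `u * D ^ m` must
    -- still hold `A`.
    obtain ⟨m, rfl⟩ : ∃ m, M = Fintype.card X + m := Nat.exists_eq_add_of_le (by omega)
    have : Nonempty (Fin (D ^ Fintype.card X)) := ⟨⟨0, hpos _⟩⟩
    refine exists_simulation_sendToBob (Y := Fin (D ^ Fintype.card X)) (R := Fin (u * D ^ m))
      ?_ ?_ ?_ ?_ hf hg
    · rw [hE, Fintype.card_fin, Fintype.card_fin, pow_add]; ring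
    · rw [Fintype.card_fin]; exact hpow le_rfl
    · rw [Fintype.card_fin]
      exact (hpow (by omega)).trans (Nat.le_mul_of_pos_left _ hu)
    · rw [hF]
      exact (hpow (by omega)).trans (Nat.le_mul_of_pos_left _ hv)
  | @sendToAlice X A B =>
    refine ⟨Fintype.card X + Fintype.card B + Fintype.card (X × A),
      fun M hM E F _ _ _ _ u v hu hv hE hF f g hf hg => ?_⟩
    obtain ⟨m, rfl⟩ : ∃ m, M = Fintype.card X + m := Nat.exists_eq_add_of_le (by omega)
    have : Nonempty (Fin (D ^ Fintype.card X)) := ⟨⟨0, hpos _⟩⟩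
    refine exists_simulation_sendToAlice (Y := Fin (D ^ Fintype.card X)) (R := Fin (v * D ^ m))
      ?_ ?_ ?_ ?_ hf hg
    · rw [hF, Fintype.card_fin, Fintype.card_fin, pow_add]; ring
    · rw [Fintype.card_fin]; exact hpow le_rfl
    · rw [Fintype.card_fin]
      exact (hpow (by omega)).trans (Nat.le_mul_of_pos_left _ hv)
    · rw [hE]
      exact (hpow (by omega)).trans (Nat.le_mul_of_pos_left _ hu)
  | comp _ _ h1 h2 =>
    obtain ⟨M₁, h1⟩ := h1
    obtain ⟨M₂, h2⟩ := h2
    refine ⟨max M₁ M₂, fun M hM E F _ _ _ _ u v hu hv hE hF f g hf hg => ?_⟩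
    obtain ⟨f', g', hf', hg', Λ', hΛ', e'⟩ :=
      h2 M (le_of_max_le_right hM) E F u v hu hv hE hF f g hf hg
    obtain ⟨f'', g'', hf'', hg'', Λ'', hΛ'', e''⟩ :=
      h1 M (le_of_max_le_left hM) E F u v hu hv hE hF f' g' hf' hg'
    exact ⟨f'', g'', hf'', hg'', _, hΛ''.comp hΛ', fun ρ => by simp [e', e'']⟩

end Simulation

/-! ### Shannon entropy inequalities. -/

section Shannon

/-- The Shannon entropy in bits. -/
def shannon {X : Type} [Fintype X] (p : X → ℝ) : ℝ :=
  ∑ x, Real.negMulLog (p x) / Real.log 2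

/-- Probability distributions on a finite type. -/
structure IsDist {X : Type} [Fintype X] (p : X → ℝ) : Prop where
  nonneg : ∀ x, 0 ≤ p x
  sum_eq_one : ∑ x, p x = 1

theorem log_two_pos : 0 < Real.log 2 := Real.log_pos one_lt_two

/-- This is log t ≤ t − 1 at t = b/a; summed over a distribution it gives Gibbs' inequality. The
condition on zeros is needed because `Real.log 0 = 0`. -/
theorem negMulLog_le_cross {a b : ℝ} (ha : 0 ≤ a) (hb : 0 ≤ b) (h : b = 0 → a = 0) :
    Real.negMulLog a ≤ a * (-Real.log b) + (b - a) := by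
  rcases ha.eq_or_lt with rfl | ha
  · simpa using hb
  have hb : 0 < b := lt_of_le_of_ne hb fun h0 => ha.ne' (h h0.symm)
  have := Real.log_le_sub_one_of_pos (div_pos hb ha)
  rw [Real.log_div hb.ne' ha.ne'] at this
  have h2 := mul_le_mul_of_nonneg_left this ha.le
  rw [mul_sub, mul_sub, mul_div_cancel₀ _ ha.ne'] at h2
  rw [Real.negMulLog]
  linarith

theorem negMulLog_lt_cross {a b : ℝ} (ha : 0 ≤ a) (hb : 0 < b) (h : a ≠ b) :
    Real.negMulLog a < a * (-Real.log b) + (b - a) := by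
  rcases ha.eq_or_lt with rfl | ha
  · simpa using hb
  have := Real.log_lt_sub_one_of_pos (div_pos hb ha)
    (by rw [Ne, div_eq_one_iff_eq ha.ne']; exact h.symm)
  rw [Real.log_div hb.ne' ha.ne'] at this
  have h2 := mul_lt_mul_of_pos_left this ha
  rw [mul_sub, mul_sub, mul_div_cancel₀ _ ha.ne'] at h2
  rw [Real.negMulLog]
  linarith

variable {X Y : Type} [Fintype X] [Fintype Y] {p : X → ℝ}

theorem IsDist.le_one (hp : IsDist p) (x : X) : p x ≤ 1 := by
  rw [← hp.sum_eq_one]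
  exact Finset.single_le_sum (fun i _ => hp.nonneg i) (Finset.mem_univ x)

theorem IsDist.nonempty (hp : IsDist p) : Nonempty X := by
  by_contra h
  rw [not_nonempty_iff] at h
  simpa using hp.sum_eq_one

theorem IsDist.shannon_nonneg (hp : IsDist p) : 0 ≤ shannon p :=
  Finset.sum_nonneg fun x _ =>
    div_nonneg (Real.negMulLog_nonneg (hp.nonneg x) (hp.le_one x)) log_two_pos.le

/-- Gibbs' inequality. -/
theorem IsDist.shannon_le_cross (hp : IsDist p) {q : X → ℝ} (hq : ∀ x, 0 ≤ q x)
    (hq1 : ∑ x, q x ≤ 1) (h : ∀ x, q x = 0 → p x = 0) :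
    shannon p ≤ ∑ x, p x * (-Real.logb 2 (q x)) := by
  have : ∑ x, Real.negMulLog (p x) ≤ ∑ x, p x * (-Real.log (q x)) := by
    have h1 := Finset.sum_le_sum fun x (_ : x ∈ Finset.univ) =>
      negMulLog_le_cross (hp.nonneg x) (hq x) (h x)
    rw [Finset.sum_add_distrib, Finset.sum_sub_distrib, hp.sum_eq_one] at h1
    linarith
  rw [shannon, ← Finset.sum_div, div_le_iff₀ log_two_pos, Finset.sum_mul]
  refine this.trans (le_of_eq (Finset.sum_congr rfl fun x _ => ?_))
  rw [Real.logb]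
  field_simp [log_two_pos.ne']

theorem IsDist.shannon_le_logb_card (hp : IsDist p) :
    shannon p ≤ Real.logb 2 (Fintype.card X) := by
  have := hp.nonempty
  have hc : (0 : ℝ) < Fintype.card X := by exact_mod_cast Fintype.card_pos
  refine (hp.shannon_le_cross (q := fun _ => (Fintype.card X : ℝ)⁻¹) (fun _ => by positivity)
    ?_ fun x h => absurd h (by positivity)).trans_eq ?_
  · simp [hc.ne']
  · rw [← Finset.sum_mul, hp.sum_eq_one, Real.logb_inv]
    ring

theorem IsDist.shannon_lt_logb_card (hp : IsDist p) {x₀ : X}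
    (hx₀ : p x₀ ≠ (Fintype.card X : ℝ)⁻¹) : shannon p < Real.logb 2 (Fintype.card X) := by
  have := hp.nonempty
  have hc : (0 : ℝ) < Fintype.card X := by exact_mod_cast Fintype.card_pos
  have hi : (0 : ℝ) < (Fintype.card X : ℝ)⁻¹ := by positivity
  have h1 := Finset.sum_lt_sum (s := Finset.univ) (fun x _ =>
      negMulLog_le_cross (hp.nonneg x) hi.le fun h => absurd h hi.ne')
      ⟨x₀, Finset.mem_univ _, negMulLog_lt_cross (hp.nonneg x₀) hi hx₀⟩
  rw [Finset.sum_add_distrib, Finset.sum_sub_distrib, ← Finset.sum_mul, hp.sum_eq_one] at h1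
  simp only [Real.log_inv, neg_neg, one_mul, Finset.sum_const, Finset.card_univ, nsmul_eq_mul,
    mul_inv_cancel₀ hc.ne', sub_self, add_zero] at h1
  rw [shannon, ← Finset.sum_div, Real.logb]
  exact div_lt_div_of_pos_right h1 log_two_pos

/-- Entropy is the mean of −log p, which is at least log d at every point of the support. -/
theorem IsDist.le_shannon_of_le (hp : IsDist p) {d : ℝ} (h : ∀ x, p x ≤ d⁻¹) :
    Real.logb 2 d ≤ shannon p := by
  have h1 : ∀ x, p x * Real.log d ≤ Real.negMulLog (p x) := fun x => by
    rcases (hp.nonneg x).eq_or_lt with h0 | h0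
    · simp [← h0]
    rw [Real.negMulLog, neg_mul, ← mul_neg]
    refine mul_le_mul_of_nonneg_left ?_ h0.le
    rw [le_neg, ← Real.log_inv]
    exact Real.log_le_log h0 (h x)
  have h2 := Finset.sum_le_sum fun x (_ : x ∈ Finset.univ) => h1 x
  rw [← Finset.sum_mul, hp.sum_eq_one, one_mul] at h2
  rw [shannon, ← Finset.sum_div, Real.logb]
  exact div_le_div_of_nonneg_right h2 log_two_pos.le

/-- Subadditivity of the Shannon entropy. -/
theorem IsDist.shannon_le_add {p : X × Y → ℝ} (hp : IsDist p) :
    shannon p ≤ shannon (fun x => ∑ y, p (x, y)) + shannon (fun y => ∑ x, p (x, y)) := by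
  set a : X → ℝ := fun x => ∑ y, p (x, y)
  set b : Y → ℝ := fun y => ∑ x, p (x, y)
  have ha : ∀ x y, p (x, y) ≤ a x := fun x y =>
    Finset.single_le_sum (f := fun y => p (x, y)) (fun i _ => hp.nonneg _) (Finset.mem_univ y)
  have hb : ∀ x y, p (x, y) ≤ b y := fun x y =>
    Finset.single_le_sum (f := fun x => p (x, y)) (fun i _ => hp.nonneg _) (Finset.mem_univ x)
  have ha0 : ∀ x, 0 ≤ a x := fun x => Finset.sum_nonneg fun _ _ => hp.nonneg _
  have hb0 : ∀ x, 0 ≤ b x := fun x => Finset.sum_nonneg fun _ _ => hp.nonneg _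
  have ha1 : ∑ x, a x = 1 := by rw [← hp.sum_eq_one, Fintype.sum_prod_type]
  have hb1 : ∑ y, b y = 1 := by rw [← hp.sum_eq_one, Fintype.sum_prod_type_right]
  have hz : ∀ i : X × Y, a i.1 * b i.2 = 0 → p i = 0 := fun i h => by
    rcases mul_eq_zero.mp h with h | h
    · exact le_antisymm ((ha i.1 i.2).trans_eq h) (hp.nonneg i)
    · exact le_antisymm ((hb i.1 i.2).trans_eq h) (hp.nonneg i)
  refine (hp.shannon_le_cross (q := fun i => a i.1 * b i.2)
    (fun i => mul_nonneg (ha0 _) (hb0 _)) ?_ hz).trans_eq ?_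
  · rw [Fintype.sum_prod_type]
    simp only [← Finset.mul_sum, hb1, ha1, mul_one, le_refl]
  · have h1 : ∀ i : X × Y, p i * (-Real.logb 2 (a i.1 * b i.2)) =
        p i * (-Real.logb 2 (a i.1)) + p i * (-Real.logb 2 (b i.2)) := fun i => by
      by_cases h : a i.1 * b i.2 = 0
      · simp [hz i h]
      · rw [Real.logb_mul (left_ne_zero_of_mul h) (right_ne_zero_of_mul h)]
        ring
    have h2 : ∀ c : ℝ, c * (-Real.logb 2 c) = Real.negMulLog c / Real.log 2 := fun c => by
      rw [Real.logb, Real.negMulLog]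
      ring
    rw [Finset.sum_congr rfl fun i _ => h1 i, Finset.sum_add_distrib, Fintype.sum_prod_type,
      Fintype.sum_prod_type_right]
    simp only [← Finset.sum_mul]
    simp only [shannon, ← h2]
    rfl

theorem shannon_mul {p : X → ℝ} {q : Y → ℝ} (hp : IsDist p) (hq : IsDist q) :
    shannon (fun i : X × Y => p i.1 * q i.2) = shannon p + shannon q := by
  simp only [shannon, ← Finset.sum_div, ← add_div]
  congr 1
  rw [Fintype.sum_prod_type]
  simp only [Real.negMulLog_mul, Finset.sum_add_distrib, ← Finset.sum_mul, ← Finset.mul_sum,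
    hq.sum_eq_one, hp.sum_eq_one, one_mul]

theorem shannon_extend {p : X → ℝ} {q : Y → ℝ} {f : X → Y} (hf : Function.Injective f)
    (h : ∀ x, q (f x) = p x) (h0 : ∀ y, y ∉ Set.range f → q y = 0) : shannon q = shannon p := by
  refine (Fintype.sum_of_injective f hf _ _ (fun y hy => ?_) fun x => by rw [h]).symm
  simp [h0 y hy]

/-- The entropy of a distribution most of whose weight lies on a small set. -/
theorem IsDist.shannon_le_of_concentrated (hp : IsDist p) (S : Finset X) {w h : ℝ}
    (hS : Real.logb 2 S.card ≤ h) (hw : w ≤ ∑ x ∈ S, p x) (h0 : 0 ≤ h) :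
    shannon p ≤ h + (1 - w) * Real.logb 2 (Fintype.card X) + 1 := by
  classical
  have := hp.nonempty
  have hc : (1 : ℝ) ≤ Fintype.card X := by exact_mod_cast Fintype.card_pos
  have hlc : 0 ≤ Real.logb 2 (Fintype.card X) := Real.logb_nonneg one_lt_two hc
  have hsplit : ∑ x ∈ S, p x + ∑ x ∈ Sᶜ, p x = 1 := by
    rw [Finset.sum_add_sum_compl, hp.sum_eq_one]
  have hS1 : ∑ x ∈ S, p x ≤ 1 := by
    have : 0 ≤ ∑ x ∈ Sᶜ, p x := Finset.sum_nonneg fun _ _ => hp.nonneg _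
    linarith
  -- For empty `S` the weight `w` is at most 0 and the trivial bound by the logarithm of the
  -- cardinality is enough.
  rcases S.eq_empty_or_nonempty with rfl | hne
  · have := hp.shannon_le_logb_card
    rw [Finset.sum_empty] at hw
    nlinarith
  have hs : (1 : ℝ) ≤ S.card := by exact_mod_cast hne.card_pos
  -- Gibbs' inequality is used against the equal mixture of the uniform distributions on `S` and on
  -- `X`; the factor 1/2 costs the one extra bit.
  set q : X → ℝ := fun x => (if x ∈ S then (2 * (S.card : ℝ))⁻¹ else 0) +
    (2 * (Fintype.card X : ℝ))⁻¹ with hq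
  have hpos2 : 0 < (2 * (Fintype.card X : ℝ))⁻¹ := by positivity
  have hpos1 : 0 < (2 * (S.card : ℝ))⁻¹ := by positivity
  have hqpos : ∀ x, 0 < q x := fun x => by
    simp only [hq]
    split_ifs <;> linarith
  have hqS : ∀ x ∈ S, -Real.logb 2 (q x) ≤ 1 + h := fun x hx => by
    have h1 : (2 * (S.card : ℝ))⁻¹ ≤ q x := by
      simp only [hq, if_pos hx]
      linarith
    have h2 := Real.logb_le_logb_of_le one_lt_two hpos1 h1
    rw [Real.logb_inv, Real.logb_mul two_ne_zero (by positivity), Real.logb_self_eq_one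
      one_lt_two] at h2
    linarith
  have hqX : ∀ x, -Real.logb 2 (q x) ≤ 1 + Real.logb 2 (Fintype.card X) := fun x => by
    have h1 : (2 * (Fintype.card X : ℝ))⁻¹ ≤ q x := by
      simp only [hq]
      split_ifs <;> linarith
    have h2 := Real.logb_le_logb_of_le one_lt_two hpos2 h1
    rw [Real.logb_inv, Real.logb_mul two_ne_zero (by positivity), Real.logb_self_eq_one
      one_lt_two] at h2
    linarith
  have hq1 : ∑ x, q x ≤ 1 := by
    simp only [hq, Finset.sum_add_distrib, Finset.sum_ite_mem, Finset.univ_inter,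
      Finset.sum_const, Finset.card_univ, nsmul_eq_mul]
    have h1 : (S.card : ℝ) * (2 * (S.card : ℝ))⁻¹ = 1 / 2 := by field_simp
    have h2 : (Fintype.card X : ℝ) * (2 * (Fintype.card X : ℝ))⁻¹ = 1 / 2 := by field_simp
    linarith
  refine (hp.shannon_le_cross (fun x => (hqpos x).le) hq1
    fun x hx => absurd hx (hqpos x).ne').trans ?_
  rw [← Finset.sum_add_sum_compl S]
  have h1 : ∑ x ∈ S, p x * (-Real.logb 2 (q x)) ≤ (∑ x ∈ S, p x) * (1 + h) := by
    rw [Finset.sum_mul]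
    exact Finset.sum_le_sum fun x hx => mul_le_mul_of_nonneg_left (hqS x hx) (hp.nonneg x)
  have h2 : ∑ x ∈ Sᶜ, p x * (-Real.logb 2 (q x)) ≤
      (∑ x ∈ Sᶜ, p x) * (1 + Real.logb 2 (Fintype.card X)) := by
    rw [Finset.sum_mul]
    exact Finset.sum_le_sum fun x _ => mul_le_mul_of_nonneg_left (hqX x) (hp.nonneg x)
  have h3 : ∑ x ∈ Sᶜ, p x = 1 - ∑ x ∈ S, p x := by linarith
  rw [h3] at h2
  nlinarith

end Shannon

/-! ### Typical sequences. -/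

section Typical

variable {K : Type} [Fintype K] {p : K → ℝ}

theorem sum_fin_succ_fun {n : ℕ} (F : (Fin (n + 1) → K) → ℝ) :
    ∑ x, F x = ∑ a, ∑ y : Fin n → K, F (Fin.cons a y) := by
  rw [← Fintype.sum_prod_type']
  exact (Fintype.sum_equiv (Fin.consEquiv fun _ => K) _ _ fun _ => rfl).symm

theorem IsDist.pow (hp : IsDist p) (n : ℕ) : IsDist (fun x : Fin n → K => ∏ i, p (x i)) := by
  refine ⟨fun x => Finset.prod_nonneg fun i _ => hp.nonneg _, ?_⟩
  induction n with
  | zero => simp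
  | succ n ih =>
    rw [sum_fin_succ_fun]
    simp only [Fin.prod_univ_succ, Fin.cons_zero, Fin.cons_succ, ← Finset.mul_sum, ih, mul_one,
      hp.sum_eq_one]

theorem IsDist.pow_mean (hp : IsDist p) {g : K → ℝ} (hg : ∑ x, p x * g x = 0) (n : ℕ) :
    ∑ x : Fin n → K, (∏ i, p (x i)) * ∑ i, g (x i) = 0 := by
  induction n with
  | zero => simp
  | succ n ih =>
    rw [sum_fin_succ_fun]
    simp only [Fin.prod_univ_succ, Fin.sum_univ_succ, Fin.cons_zero, Fin.cons_succ, mul_add,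
      Finset.sum_add_distrib]
    have h1 : ∀ a, ∑ y : Fin n → K, p a * (∏ i, p (y i)) * g a = p a * g a := fun a => by
      rw [← Finset.sum_mul, ← Finset.mul_sum, (hp.pow n).sum_eq_one, mul_one]
    have h2 : ∀ a, ∑ y : Fin n → K, p a * (∏ i, p (y i)) * ∑ i, g (y i) = 0 := fun a => by
      simp only [mul_assoc, ← Finset.mul_sum, ih, mul_zero]
    simp only [h1, h2, hg, Finset.sum_const_zero, add_zero]

/-- Variances of independent centred variables add: the cross terms vanish by `IsDist.pow_mean`. -/
theorem IsDist.pow_variance (hp : IsDist p) {g : K → ℝ} (hg : ∑ x, p x * g x = 0) (n : ℕ) :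
    ∑ x : Fin n → K, (∏ i, p (x i)) * (∑ i, g (x i)) ^ 2 = n * ∑ x, p x * g x ^ 2 := by
  induction n with
  | zero => simp
  | succ n ih =>
    rw [sum_fin_succ_fun]
    simp only [Fin.prod_univ_succ, Fin.sum_univ_succ, Fin.cons_zero, Fin.cons_succ]
    have h1 : ∀ a, ∑ y : Fin n → K, p a * (∏ i, p (y i)) * (g a + ∑ i, g (y i)) ^ 2 =
        p a * g a ^ 2 + p a * (n * ∑ x, p x * g x ^ 2) := fun a => by
      have : ∀ y : Fin n → K, p a * (∏ i, p (y i)) * (g a + ∑ i, g (y i)) ^ 2 =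
          p a * g a ^ 2 * (∏ i, p (y i)) + 2 * p a * g a * ((∏ i, p (y i)) * ∑ i, g (y i)) +
          p a * ((∏ i, p (y i)) * (∑ i, g (y i)) ^ 2) := fun y => by ring
      simp only [this, Finset.sum_add_distrib, ← Finset.mul_sum, (hp.pow n).sum_eq_one,
        hp.pow_mean hg, ih]
      ring
    simp only [h1, Finset.sum_add_distrib, ← Finset.sum_mul, hp.sum_eq_one]
    push_cast
    ring

/-- The asymptotic equipartition property. -/
theorem IsDist.exists_typical (hp : IsDist p) {ε δ : ℝ} (hε : 0 < ε) (hδ : 0 < δ) :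
    ∀ᶠ n : ℕ in atTop, ∃ T : Finset (Fin n → K),
      (T.card : ℝ) ≤ 2 ^ (n * (shannon p + ε)) ∧ 1 - δ ≤ ∑ x ∈ T, ∏ i, p (x i) := by
  classical
  -- The centred surprisal.
  set g : K → ℝ := fun x => -Real.logb 2 (p x) - shannon p with hgdef
  have hg : ∑ x, p x * g x = 0 := by
    simp only [hgdef, mul_sub, Finset.sum_sub_distrib, ← Finset.sum_mul, hp.sum_eq_one, one_mul]
    rw [sub_eq_zero, shannon]
    refine Finset.sum_congr rfl fun x _ => ?_
    rw [Real.logb, Real.negMulLog]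
    ring
  set V := ∑ x, p x * g x ^ 2
  have hlim : Tendsto (fun n : ℕ => V / ε ^ 2 / (n : ℝ)) atTop (𝓝 0) :=
    tendsto_const_div_atTop_nhds_zero_nat _
  filter_upwards [hlim.eventually (gt_mem_nhds hδ), eventually_ge_atTop 1] with n hn hn1
  have hn0 : (0 : ℝ) < n := by exact_mod_cast hn1
  -- Only the upper tail is cut, since no lower bound on the cardinality is needed. Zero
  -- probabilities are excluded by hand: `Real.logb 2 0 = 0` would give them small surprisal.
  set T : Finset (Fin n → K) :=
    Finset.univ.filter fun x => (∀ i, p (x i) ≠ 0) ∧ ∑ i, g (x i) ≤ n * ε with hT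
  have hw := hp.pow n
  refine ⟨T, ?_, ?_⟩
  · have h1 : ∀ x ∈ T, (2 : ℝ) ^ (-(n * (shannon p + ε))) ≤ ∏ i, p (x i) := fun x hx => by
      obtain ⟨h0, hx⟩ := (Finset.mem_filter.mp hx).2
      have hp0 : ∀ i, 0 < p (x i) := fun i => lt_of_le_of_ne (hp.nonneg _) (h0 i).symm
      have : ∏ i, p (x i) = (2 : ℝ) ^ (∑ i, Real.logb 2 (p (x i))) := by
        rw [Real.rpow_sum_of_pos two_pos]
        exact Finset.prod_congr rfl fun i _ =>
          (Real.rpow_logb two_pos (by norm_num) (hp0 i)).symm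
      rw [this]
      refine Real.rpow_le_rpow_of_exponent_le one_le_two ?_
      simp only [hgdef, Finset.sum_sub_distrib, Finset.sum_neg_distrib, Finset.sum_const,
        Finset.card_univ, Fintype.card_fin, nsmul_eq_mul] at hx
      linarith
    have h2 : (T.card : ℝ) * (2 : ℝ) ^ (-(n * (shannon p + ε))) ≤ 1 := by
      rw [← hw.sum_eq_one, ← nsmul_eq_mul]
      exact (Finset.card_nsmul_le_sum T _ _ h1).trans
        (Finset.sum_le_univ_sum_of_nonneg hw.nonneg)
    rw [Real.rpow_neg two_pos.le] at h2
    rwa [← div_eq_mul_inv, div_le_one (Real.rpow_pos_of_pos two_pos _)] at h2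
  -- Chebyshev's inequality for the complement of `T`.
  · have h3 : (∑ x ∈ Tᶜ, ∏ i, p (x i)) * (n * ε) ^ 2 ≤ n * V := by
      rw [← hp.pow_variance hg n, Finset.sum_mul]
      refine (Finset.sum_le_sum fun x hx => ?_).trans
        (Finset.sum_le_univ_sum_of_nonneg fun x => mul_nonneg (hw.nonneg x) (sq_nonneg _))
      by_cases h0 : ∀ i, p (x i) ≠ 0
      · refine mul_le_mul_of_nonneg_left ?_ (hw.nonneg x)
        have : ¬ ∑ i, g (x i) ≤ n * ε := fun h =>
          Finset.mem_compl.mp hx (Finset.mem_filter.mpr ⟨Finset.mem_univ _, h0, h⟩)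
        exact pow_le_pow_left₀ (by positivity) (not_le.mp this).le 2
      · push Not at h0
        obtain ⟨i, hi⟩ := h0
        have : ∏ j, p (x j) = 0 := Finset.prod_eq_zero (Finset.mem_univ i) hi
        simp [this]
    have h4 : ∑ x ∈ T, ∏ i, p (x i) + ∑ x ∈ Tᶜ, ∏ i, p (x i) = 1 := by
      rw [Finset.sum_add_sum_compl, hw.sum_eq_one]
    have h5 : ∑ x ∈ Tᶜ, ∏ i, p (x i) ≤ V / ε ^ 2 / n := by
      rw [div_div, le_div_iff₀ (by positivity)]
      refine le_of_mul_le_mul_right ?_ hn0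
      linarith
    linarith

end Typical

/-! ### Handing everything over to Bob as a classical state. -/

section Collect

/-- The state that Bob holds when everything has been sent to him and has been dephased in the
standard basis. -/
def collect {A B : Type} [DecidableEq A] [DecidableEq B] (σ : BiOp A B) : BiOp Unit (A × B) :=
  Matrix.diagonal fun i => σ i.2 i.2

/-- The classical state `p` held by Bob. -/
abbrev bobDist {J : Type} [DecidableEq J] (p : J → ℝ) : BiOp Unit J :=
  diagOp fun i => p i.2

variable {A B A' B' J : Type} [Fintype A] [DecidableEq A] [Fintype B] [DecidableEq B]
    [Fintype A'] [DecidableEq A'] [Fintype B'] [DecidableEq B'] [Fintype J] [DecidableEq J]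

/-- Alice's system is dephased on its way to Bob. A round trip of the whole system to Alice and back
then dephases Bob's part as well. -/
theorem isCLOCC_collect : IsCLOCC (collect : BiOp A B → BiOp Unit (A × B)) := by
  have c := (IsCLOCC.relabel (Equiv.refl Unit) (Equiv.prodPUnit.{0} (A × B))).comp <|
    IsCLOCC.sendToBob.comp <| IsCLOCC.sendToAlice.comp <|
    (IsCLOCC.relabel (Equiv.refl Unit) (Equiv.prodPUnit.{0} (A × B)).symm).comp <|
    IsCLOCC.sendToBob.comp (IsCLOCC.relabel (Equiv.prodPUnit.{0} A).symm (Equiv.refl B))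
  convert c using 1
  funext σ
  ext ⟨_, a, b⟩ ⟨_, a', b'⟩
  by_cases ha : a = a' <;> by_cases hb : b = b' <;>
    simp [collect, relabel, sendToBob, sendToAlice, ha, hb]

/-- The diagonal of an operator, as real numbers. -/
def diagRe {I : Type} (M : Matrix I I ℂ) (i : I) : ℝ := (M i i).re

theorem IsState.isDist_diagRe {I : Type} [Fintype I] {M : Matrix I I ℂ} (hM : IsState M) :
    IsDist (diagRe M) := by
  refine ⟨fun i => (Complex.nonneg_iff.mp hM.1.diag_nonneg).1, ?_⟩
  have := congrArg Complex.re hM.2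
  rwa [Matrix.trace, Complex.re_sum] at this

theorem posSemidef_diagRe {I : Type} {M : Matrix I I ℂ} (hM : M.PosSemidef) (i : I) :
    ((diagRe M i : ℝ) : ℂ) = M i i :=
  (Complex.eq_re_of_ofReal_le hM.diag_nonneg).symm

theorem reach_collect {σ : BiOp A B} (hσ : IsState σ) : Reach σ (bobDist (diagRe σ)) := by
  refine ⟨_, isCLOCC_collect, ?_⟩
  simp only [collect, bobDist, diagOp, posSemidef_diagRe hσ.1]

theorem diagRe_diagOp (P : A × B → ℝ) : diagRe (diagOp P) = P := by
  funext i
  simp [diagRe, diagOp]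

theorem isState_diagOp {P : A × B → ℝ} (hP : IsDist P) : IsState (diagOp P) := by
  refine ⟨Matrix.PosSemidef.diagonal fun i => ?_, ?_⟩
  · simpa using hP.nonneg i
  · rw [diagOp, Matrix.trace_diagonal]
    exact_mod_cast hP.sum_eq_one

theorem IsState.isDist_of_diagOp {P : A × B → ℝ} (hP : IsState (diagOp P)) : IsDist P := by
  simpa [diagRe_diagOp] using hP.isDist_diagRe

theorem isDist_unit_prod_iff {p : J → ℝ} : IsDist (fun i : Unit × J => p i.2) ↔ IsDist p := by
  constructor
  · rintro ⟨h0, h1⟩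
    exact ⟨fun x => h0 ((), x), by simpa [Fintype.sum_prod_type] using h1⟩
  · rintro ⟨h0, h1⟩
    exact ⟨fun x => h0 x.2, by simpa [Fintype.sum_prod_type] using h1⟩

theorem IsState.isDist_of_bobDist {p : J → ℝ} (hp : IsState (bobDist p)) : IsDist p :=
  isDist_unit_prod_iff.mp hp.isDist_of_diagOp

theorem relabel_diagOp (e : A ≃ A') (f : B ≃ B') (P : A × B → ℝ) :
    relabel e f (diagOp P) = diagOp (fun i => P (e.symm i.1, f.symm i.2)) := by
  ext ⟨a, b⟩ ⟨a', b'⟩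
  simp [relabel, diagOp, Matrix.diagonal_apply]

theorem reach_diagOp_relabel (e : A ≃ A') (f : B ≃ B') (P : A × B → ℝ) :
    Reach (diagOp P) (diagOp (fun i : A' × B' => P (e.symm i.1, f.symm i.2))) := by
  rw [← relabel_diagOp]
  exact reach_relabel e f _

theorem tensor_diagOp {C D : Type} [DecidableEq C] [DecidableEq D] (P : A × B → ℝ) (Q : C × D → ℝ) :
    tensor (diagOp P) (diagOp Q) =
      diagOp (fun i : (A × C) × (B × D) => P (i.1.1, i.2.1) * Q (i.1.2, i.2.2)) := by
  ext ⟨⟨a, c⟩, ⟨b, d⟩⟩ ⟨⟨a', c'⟩, ⟨b', d'⟩⟩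
  simp only [tensor, diagOp, Matrix.diagonal_apply, Matrix.of_apply, Prod.ext_iff, ite_mul,
    zero_mul, mul_ite, mul_zero, ← ite_and, Complex.ofReal_mul]
  exact if_congr (by tauto) rfl rfl

/-- A diagonal state on both sides can be handed over to Bob entirely. -/
theorem reach_diagOp_bobDist {P : A × B → ℝ} (hP : IsDist P) : Reach (diagOp P) (bobDist P) := by
  simpa [diagRe_diagOp] using reach_collect (isState_diagOp hP)

theorem Reach.bobDist_tensor {C D K : Type} [Fintype C] [DecidableEq C] [Fintype D] [DecidableEq D]
    [Fintype K] [DecidableEq K] {ρ : BiOp A B} {σ : BiOp C D} {p : J → ℝ} {q : K → ℝ}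
    (h : Reach ρ (bobDist p)) (h' : Reach σ (bobDist q)) :
    Reach (LocalInfo.tensor ρ σ) (bobDist fun i : J × K => p i.1 * q i.2) := by
  refine (h.tensor h').trans ?_
  rw [tensor_diagOp]
  exact reach_diagOp_relabel (Equiv.prodPUnit.{0} Unit) (Equiv.refl (J × K)) _

theorem tensorPow_diagOp (P : A × B → ℝ) (n : ℕ) :
    tensorPow n (diagOp P) =
      diagOp (fun i : (Fin n → A) × (Fin n → B) => ∏ k, P (i.1 k, i.2 k)) := by
  ext ⟨a, b⟩ ⟨a', b'⟩
  simp only [tensorPow, diagOp, Matrix.diagonal_apply, Matrix.of_apply, Prod.ext_iff]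
  by_cases h : a = a' ∧ b = b'
  · obtain ⟨rfl, rfl⟩ := h
    simp
  · rw [if_neg h]
    have : ∃ k, ¬ (a k = a' k ∧ b k = b' k) := by
      by_contra hk
      push Not at hk
      exact h ⟨funext fun k => (hk k).1, funext fun k => (hk k).2⟩
    obtain ⟨k, hk⟩ := this
    exact Finset.prod_eq_zero (Finset.mem_univ k) (if_neg hk)

theorem Reach.bobDist_pow {ρ : BiOp A B} {p : J → ℝ} (h : Reach ρ (bobDist p)) (n : ℕ) :
    Reach (LocalInfo.tensorPow n ρ) (bobDist fun x : Fin n → J => ∏ i, p (x i)) := by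
  refine (h.tensorPow n).trans ?_
  rw [bobDist, tensorPow_diagOp]
  exact reach_diagOp_relabel (Equiv.ofUnique (Fin n → Unit) Unit) (Equiv.refl (Fin n → J)) _

end Collect

/-! ### Localisable information in terms of classical states at Bob. -/

section Info

variable {A B A' B' J : Type} [Fintype A] [DecidableEq A] [Fintype B] [DecidableEq B]
    [Fintype A'] [DecidableEq A'] [Fintype B'] [DecidableEq B'] [Fintype J] [DecidableEq J]

/-- The eigenvalues are the diagonal entries up to order, as both are the multiset of roots of the
characteristic polynomial, and the entropy depends only on that multiset. -/
theorem entropy_diagonal (p : J → ℝ) : entropy (Matrix.diagonal fun x => (p x : ℂ)) = shannon p := by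
  have hH : (Matrix.diagonal fun x => (p x : ℂ)).IsHermitian :=
    Matrix.isHermitian_diagonal_of_self_adjoint _ (by ext; simp)
  rw [entropy, dif_pos hH, shannon]
  have h1 := hH.roots_charpoly_eq_eigenvalues
  have h0 := Polynomial.roots_multiset_prod_X_sub_C
    ((Finset.univ : Finset J).val.map fun x => (p x : ℂ))
  rw [Multiset.map_map] at h0
  rw [Matrix.charpoly_diagonal] at h1
  have h1 := h0.symm.trans h1
  have h2 := congrArg (fun s => (s.map fun z : ℂ => Real.negMulLog z.re / Real.log 2).sum) h1
  simp only [Multiset.map_map] at h2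
  exact h2.symm

theorem marginalA_bobDist {p : J → ℝ} (hp : IsDist p) :
    marginalA (bobDist p) = Matrix.diagonal fun _ : Unit => ((1 : ℝ) : ℂ) := by
  ext i j
  obtain rfl : i = j := Subsingleton.elim _ _
  have := hp.sum_eq_one
  rw [Matrix.diagonal_apply_eq, ← this, Complex.ofReal_sum]
  exact Finset.sum_congr rfl fun b _ => Matrix.diagonal_apply_eq _ _

theorem marginalB_bobDist (p : J → ℝ) :
    marginalB (bobDist p) = Matrix.diagonal fun x => (p x : ℂ) := by
  ext i j
  simp [marginalB, diagOp, Matrix.diagonal_apply]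

theorem info_bobDist {p : J → ℝ} (hp : IsDist p) :
    info (marginalA (bobDist p)) + info (marginalB (bobDist p)) =
      Real.logb 2 (Fintype.card J) - shannon p := by
  rw [marginalA_bobDist hp, marginalB_bobDist, info, info, entropy_diagonal, entropy_diagonal]
  simp [shannon]

theorem Reach.mem_locInfoSet {ρ : BiOp A B} {p : J → ℝ} (h : Reach ρ (bobDist p)) (hp : IsDist p) :
    Real.logb 2 (Fintype.card A * Fintype.card B) - shannon p ∈ locInfoSet ρ := by
  have hc := h.card_eq
  obtain ⟨Λ, hΛ, e⟩ := h
  refine ⟨Unit, J, inferInstance, inferInstance, inferInstance, inferInstance, Λ, hΛ, ?_⟩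
  rw [e, info_bobDist hp]
  rw [Fintype.card_unit, one_mul] at hc
  rw [← hc]
  push_cast
  rfl

theorem marginalA_localUnitary (U : Matrix.unitaryGroup A ℂ) (V : Matrix.unitaryGroup B ℂ)
    (σ : BiOp A B) : marginalA (localUnitary U V σ) =
      (U : Matrix A A ℂ) * marginalA σ * (U : Matrix A A ℂ)ᴴ := by
  have hV : ∀ k l, ∑ b, (V : Matrix B B ℂ) b k * star ((V : Matrix B B ℂ) b l) =
      if l = k then 1 else 0 := fun k l => by
    have := congrFun (congrFun (Matrix.mem_unitaryGroup_iff'.mp V.2) l) k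
    rw [Matrix.mul_apply, Matrix.one_apply] at this
    rw [← this]
    exact Finset.sum_congr rfl fun b _ => mul_comm _ _
  ext a a'
  simp only [marginalA, localUnitary, Matrix.mul_apply, Matrix.of_apply,
    Matrix.conjTranspose_apply, Matrix.kroneckerMap_apply, Fintype.sum_prod_type, star_mul',
    Finset.sum_mul, Finset.mul_sum]
  have e1 : ∀ b l k c d, (U : Matrix A A ℂ) a c * (V : Matrix B B ℂ) b d * σ (c, d) (l, k) *
      (star ((U : Matrix A A ℂ) a' l) * star ((V : Matrix B B ℂ) b k)) =
      (U : Matrix A A ℂ) a c * σ (c, d) (l, k) * star ((U : Matrix A A ℂ) a' l) *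
        ((V : Matrix B B ℂ) b d * star ((V : Matrix B B ℂ) b k)) := by intros; ring
  simp only [e1]
  rw [Finset.sum_comm]
  refine Finset.sum_congr rfl fun l _ => ?_
  simp_rw [Finset.sum_comm (s := (Finset.univ : Finset B)) (t := (Finset.univ : Finset A))]
  refine Finset.sum_congr rfl fun c _ => ?_
  rw [Finset.sum_comm]
  have e2 : ∀ k, ∑ b, ∑ d, (U : Matrix A A ℂ) a c * σ (c, d) (l, k) *
      star ((U : Matrix A A ℂ) a' l) * ((V : Matrix B B ℂ) b d * star ((V : Matrix B B ℂ) b k)) =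
      (U : Matrix A A ℂ) a c * σ (c, k) (l, k) * star ((U : Matrix A A ℂ) a' l) := fun k => by
    rw [Finset.sum_comm]
    simp only [← Finset.mul_sum, hV, mul_ite, mul_one, mul_zero, Finset.sum_ite_eq,
      Finset.mem_univ, if_true]
  simp only [e2]

theorem marginalB_eq_marginalA_swap (σ : BiOp A B) :
    marginalB σ = marginalA (Matrix.of fun i j : B × A => σ i.swap j.swap) := rfl

theorem marginalB_localUnitary (U : Matrix.unitaryGroup A ℂ) (V : Matrix.unitaryGroup B ℂ)
    (σ : BiOp A B) : marginalB (localUnitary U V σ) =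
      (V : Matrix B B ℂ) * marginalB σ * (V : Matrix B B ℂ)ᴴ := by
  rw [marginalB_eq_marginalA_swap, marginalB_eq_marginalA_swap, ← marginalA_localUnitary V U]
  congr 1
  have hK : (U : Matrix A A ℂ) ⊗ₖ (V : Matrix B B ℂ) = ((V : Matrix B B ℂ) ⊗ₖ
      (U : Matrix A A ℂ)).submatrix (Equiv.prodComm A B) (Equiv.prodComm A B) := by
    ext ⟨a, b⟩ ⟨a', b'⟩
    simp [mul_comm]
  have hσ : σ = (Matrix.of fun i j : B × A => σ i.swap j.swap).submatrix
      (Equiv.prodComm A B) (Equiv.prodComm A B) := by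
    ext ⟨a, b⟩ ⟨a', b'⟩
    simp
  rw [localUnitary, hK]
  conv_lhs => rw [hσ]
  rw [Matrix.conjTranspose_submatrix, Matrix.submatrix_mul_equiv, Matrix.submatrix_mul_equiv]
  rfl

theorem isHermitian_marginalA {σ : BiOp A B} (hσ : σ.IsHermitian) : (marginalA σ).IsHermitian := by
  ext a a'
  simp only [Matrix.conjTranspose_apply, marginalA, Matrix.of_apply, star_sum]
  exact Finset.sum_congr rfl fun b _ => hσ.apply _ _

theorem isHermitian_marginalB {σ : BiOp A B} (hσ : σ.IsHermitian) : (marginalB σ).IsHermitian := by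
  ext a a'
  simp only [Matrix.conjTranspose_apply, marginalB, Matrix.of_apply, star_sum]
  exact Finset.sum_congr rfl fun b _ => hσ.apply _ _

theorem star_eigenvectorUnitary_conj {M : Matrix A A ℂ} (hM : M.IsHermitian) :
    ((star hM.eigenvectorUnitary : Matrix.unitaryGroup A ℂ) : Matrix A A ℂ) * M *
      ((star hM.eigenvectorUnitary : Matrix.unitaryGroup A ℂ) : Matrix A A ℂ)ᴴ =
      Matrix.diagonal fun a => (hM.eigenvalues a : ℂ) := by
  have := hM.conjStarAlgAut_star_eigenvectorUnitary
  rw [Unitary.conjStarAlgAut_apply] at this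
  exact this

/-- The value of a protocol is attained, or exceeded, by one that leaves Bob with everything, in a
classical state. -/
theorem exists_bobDist_of_mem_locInfoSet {ρ : BiOp A B} (hρ : IsState ρ) {x : ℝ}
    (hx : x ∈ locInfoSet ρ) :
    ∃ (J : Type) (_ : Fintype J) (_ : DecidableEq J) (p : J → ℝ), IsDist p ∧
      Reach ρ (bobDist p) ∧ x ≤ Real.logb 2 (Fintype.card A * Fintype.card B) - shannon p := by
  obtain ⟨A', B', _, _, _, _, Λ, hΛ, rfl⟩ := hx
  have hσ := hΛ.isState hρ
  set σ := Λ ρ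
  have hA := isHermitian_marginalA hσ.1.1
  have hB := isHermitian_marginalB hσ.1.1
  -- In the eigenbases of the two reduced states, the diagonal of the joint state is a distribution
  -- whose marginals are the two spectra.
  set τ := localUnitary (star hA.eigenvectorUnitary) (star hB.eigenvectorUnitary) σ with hτdef
  have hc : IsCLOCC (localUnitary (star hA.eigenvectorUnitary) (star hB.eigenvectorUnitary)) :=
    IsCLOCC.localUnitary _ _
  have hτ : IsState τ := hc.isState hσ
  have hr : Reach ρ (bobDist (diagRe τ)) :=
    Reach.trans ⟨Λ, hΛ, rfl⟩ (Reach.trans ⟨_, hc, rfl⟩ (reach_collect hτ))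
  refine ⟨A' × B', inferInstance, inferInstance, _, hτ.isDist_diagRe, hr, ?_⟩
  have eA : (fun a => ∑ b, diagRe τ (a, b)) = hA.eigenvalues := by
    have := marginalA_localUnitary (star hA.eigenvectorUnitary) (star hB.eigenvectorUnitary) σ
    rw [star_eigenvectorUnitary_conj] at this
    funext a
    have h2 := congrArg Complex.re (congrFun (congrFun this a) a)
    simpa [marginalA, diagRe, hτdef] using h2
  have eB : (fun b => ∑ a, diagRe τ (a, b)) = hB.eigenvalues := by
    have := marginalB_localUnitary (star hA.eigenvectorUnitary) (star hB.eigenvectorUnitary) σ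
    rw [star_eigenvectorUnitary_conj] at this
    funext b
    have h2 := congrArg Complex.re (congrFun (congrFun this b) b)
    simpa [marginalB, diagRe, hτdef] using h2
  -- Subadditivity: dephasing jointly costs no more entropy than the two reduced states have
  -- together.
  have hS := hτ.isDist_diagRe.shannon_le_add
  rw [eA, eB] at hS
  have hd := hτ.isDist_diagRe.nonempty
  have hA0 : (Fintype.card A' : ℝ) ≠ 0 := by
    have : Nonempty A' := ⟨hd.some.1⟩
    exact_mod_cast Fintype.card_ne_zero
  have hB0 : (Fintype.card B' : ℝ) ≠ 0 := by
    have : Nonempty B' := ⟨hd.some.2⟩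
    exact_mod_cast Fintype.card_ne_zero
  have hcard : (Fintype.card A : ℝ) * Fintype.card B = Fintype.card A' * Fintype.card B' := by
    exact_mod_cast hΛ.card_eq
  rw [hcard, Real.logb_mul hA0 hB0, info, info, entropy, entropy, dif_pos hA, dif_pos hB]
  simp only [shannon] at hS ⊢
  linarith

theorem locInfoSet_le {ρ : BiOp A B} (hρ : IsState ρ) {x : ℝ} (hx : x ∈ locInfoSet ρ) :
    x ≤ Real.logb 2 (Fintype.card A * Fintype.card B) := by
  obtain ⟨J, _, _, p, hp, -, h⟩ := exists_bobDist_of_mem_locInfoSet hρ hx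
  linarith [hp.shannon_nonneg]

theorem bddAbove_locInfoSet {ρ : BiOp A B} (hρ : IsState ρ) : BddAbove (locInfoSet ρ) :=
  ⟨_, fun _ hx => locInfoSet_le hρ hx⟩

theorem locInfoSet_nonempty {ρ : BiOp A B} (hρ : IsState ρ) : (locInfoSet ρ).Nonempty :=
  ⟨_, (reach_collect hρ).mem_locInfoSet hρ.isDist_diagRe⟩

theorem locInfo_le {ρ : BiOp A B} (hρ : IsState ρ) :
    locInfo ρ ≤ Real.logb 2 (Fintype.card A * Fintype.card B) :=
  csSup_le (locInfoSet_nonempty hρ) fun _ hx => locInfoSet_le hρ hx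

theorem Reach.le_locInfo {ρ : BiOp A B} (hρ : IsState ρ) {p : J → ℝ} (h : Reach ρ (bobDist p)) :
    Real.logb 2 (Fintype.card A * Fintype.card B) - shannon p ≤ locInfo ρ :=
  le_csSup (bddAbove_locInfoSet hρ) (h.mem_locInfoSet (h.isState hρ).isDist_of_bobDist)

theorem locInfo_nonneg {ρ : BiOp A B} (hρ : IsState ρ) : 0 ≤ locInfo ρ := by
  have h1 := (reach_collect hρ).le_locInfo hρ
  have h2 := hρ.isDist_diagRe.shannon_le_logb_card
  rw [Fintype.card_prod] at h2
  push_cast at h2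
  linarith

/-- It suffices to bound the values of protocols that leave Bob with everything. -/
theorem locInfo_le_of_forall_bobDist {ρ : BiOp A B} (hρ : IsState ρ) {c : ℝ}
    (h : ∀ (J : Type) [Fintype J] [DecidableEq J] (p : J → ℝ), IsDist p → Reach ρ (bobDist p) →
      Real.logb 2 (Fintype.card A * Fintype.card B) - shannon p ≤ c) : locInfo ρ ≤ c := by
  refine csSup_le (locInfoSet_nonempty hρ) fun x hx => ?_
  obtain ⟨J, _, _, p, hp, hr, hx⟩ := exists_bobDist_of_mem_locInfoSet hρ hx
  exact hx.trans (h J p hp hr)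

theorem Reach.locInfo_le {ρ : BiOp A B} {σ : BiOp A' B'} (h : Reach ρ σ) (hρ : IsState ρ) :
    locInfo σ ≤ locInfo ρ := by
  refine locInfo_le_of_forall_bobDist (h.isState hρ) fun J _ _ p _ hr => ?_
  have := (h.trans hr).le_locInfo hρ
  have hc : (Fintype.card A : ℝ) * Fintype.card B = Fintype.card A' * Fintype.card B' := by
    exact_mod_cast h.card_eq
  rwa [hc] at this

theorem IsState.card_pos {ρ : BiOp A B} (hρ : IsState ρ) :
    0 < Fintype.card A ∧ 0 < Fintype.card B := by
  obtain ⟨a, b⟩ := hρ.isDist_diagRe.nonempty.some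
  exact ⟨Fintype.card_pos_iff.mpr ⟨a⟩, Fintype.card_pos_iff.mpr ⟨b⟩⟩

theorem isState_tensor {C D : Type} [Fintype C] [DecidableEq C] [Fintype D] [DecidableEq D]
    {ρ : BiOp A B} {σ : BiOp C D} (hρ : IsState ρ) (hσ : IsState σ) : IsState (tensor ρ σ) := by
  refine ⟨(hρ.1.kronecker hσ.1).submatrix (Equiv.prodProdProdComm A C B D), ?_⟩
  rw [tensor_eq_submatrix]
  have := Matrix.trace_kronecker ρ σ
  rw [hρ.2, hσ.2, one_mul] at this
  rw [← this]
  exact Fintype.sum_equiv (Equiv.prodProdProdComm A C B D) _ _ fun _ => rfl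

theorem isState_tensorPow {ρ : BiOp A B} (hρ : IsState ρ) (n : ℕ) : IsState (tensorPow n ρ) := by
  induction n with
  | zero =>
    have : tensorPow 0 ρ = 1 := by
      ext ⟨a, b⟩ ⟨a', b'⟩
      simp [tensorPow, Matrix.one_apply, Subsingleton.elim a a', Subsingleton.elim b b']
    rw [this]
    exact ⟨Matrix.PosSemidef.one, by simp [Matrix.trace_one]⟩
  | succ n ih =>
    exact (reach_tensorPow_add' ρ n 1).isState
      (isState_tensor ih ((reach_tensorPow_one ρ).isState hρ))

/-- Run the two protocols in parallel; entropies and logarithms of dimensions both add. -/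
theorem locInfo_add_le_tensor {C D : Type} [Fintype C] [DecidableEq C] [Fintype D] [DecidableEq D]
    {ρ : BiOp A B} {σ : BiOp C D} (hρ : IsState ρ) (hσ : IsState σ) :
    locInfo ρ + locInfo σ ≤ locInfo (tensor ρ σ) := by
  rw [← le_sub_iff_add_le]
  refine locInfo_le_of_forall_bobDist hρ fun J _ _ p hp hr => ?_
  rw [le_sub_iff_add_le, add_comm, ← le_sub_iff_add_le]
  refine locInfo_le_of_forall_bobDist hσ fun K _ _ q hq hr' => ?_
  have h := (hr.bobDist_tensor hr').le_locInfo (isState_tensor hρ hσ)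
  rw [shannon_mul hp hq, Fintype.card_prod, Fintype.card_prod] at h
  have h1 := hρ.card_pos
  have h2 := hσ.card_pos
  have e : Real.logb 2 (((Fintype.card A * Fintype.card C : ℕ) : ℝ) *
      ((Fintype.card B * Fintype.card D : ℕ) : ℝ)) =
      Real.logb 2 (Fintype.card A * Fintype.card B) +
        Real.logb 2 (Fintype.card C * Fintype.card D) := by
    rw [← Real.logb_mul]
    · push_cast
      congr 1
      ring
    · exact_mod_cast (Nat.mul_pos h1.1 h1.2).ne'
    · exact_mod_cast (Nat.mul_pos h2.1 h2.2).ne'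
  rw [e] at h
  linarith

end Info

/-! ### Blank registers: creating them by compression, using them, restoring them. -/

section Recycling

variable {A B C D E J J' K : Type} [Fintype A] [DecidableEq A] [Fintype B] [DecidableEq B]
    [Fintype C] [DecidableEq C] [Fintype D] [DecidableEq D] [Fintype E] [DecidableEq E]
    [Fintype J] [DecidableEq J] [Fintype J'] [DecidableEq J'] [Fintype K] [DecidableEq K]

/-- Bob can hand over part of a classical state to Alice. -/
theorem reach_bobDist_diagOp (P : A × B → ℝ) : Reach (bobDist P) (diagOp P) := by
  have c := (IsCLOCC.relabel (Equiv.prodPUnit.{0} A) (Equiv.refl B)).comp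
    (IsCLOCC.sendToAlice (X := A) (A := Unit) (B := B))
  refine ⟨_, c, ?_⟩
  ext ⟨a, b⟩ ⟨a', b'⟩
  by_cases ha : a = a' <;> simp [relabel, sendToAlice, diagOp, Matrix.diagonal_apply, ha]

theorem reach_dephase {σ : BiOp A B} (hσ : IsState σ) : Reach σ (diagOp (diagRe σ)) :=
  (reach_collect hσ).trans (reach_bobDist_diagOp _)

/-- `σ` can be transformed into a classical state in which both parties hold a register `E`, whose
blank state is `e₀`, and Bob holds some `J` in addition. With weight at least `w`, both registers are
blank and Bob's remaining system is confined to a set of at most `2 ^ h` values. -/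
def YieldsBlanks (σ : BiOp A B) (e₀ : E) (h w : ℝ) : Prop :=
  ∃ (J : Type) (_ : Fintype J) (_ : DecidableEq J) (G : Finset J) (P : E × (J × E) → ℝ),
    Reach σ (diagOp P) ∧ Real.logb 2 G.card ≤ h ∧ w ≤ ∑ j ∈ G, P (e₀, (j, e₀))

theorem Reach.yieldsBlanks {σ : BiOp A B} {τ : BiOp C D} {e₀ : E} {h w : ℝ} (hr : Reach σ τ)
    (hτ : YieldsBlanks τ e₀ h w) : YieldsBlanks σ e₀ h w := by
  obtain ⟨J, _, _, G, P, hP, hG, hw⟩ := hτ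
  exact ⟨J, _, _, G, P, hr.trans hP, hG, hw⟩

/-- Compression of a classical state with a small typical set yields blank registers. -/
theorem exists_compression (p : K → ℝ) (T : Finset K) (e₀ : E)
    (hK : Fintype.card K = Fintype.card E * (Fintype.card J * Fintype.card E))
    (hT : T.card ≤ Fintype.card J) :
    ∃ (G : Finset J) (P : E × (J × E) → ℝ), G.card = T.card ∧ Reach (bobDist p) (diagOp P) ∧
      ∑ j ∈ G, P (e₀, (j, e₀)) = ∑ t ∈ T, p t := by
  obtain ⟨ι, hι⟩ := exists_injective_of_card_le (I := T) (K := J) (by simpa using hT)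
  -- The label permutation packs the set `T` into `J`, so each of its values leaves both registers
  -- at `e₀`.
  obtain ⟨e, he⟩ := exists_equiv_extending (f := fun t : T => (t : K))
    (g := fun t : T => (e₀, (ι t, e₀))) Subtype.val_injective (fun s t h => by simpa [hι.eq_iff] using h)
    (show Fintype.card K = Fintype.card (E × (J × E)) by simpa using hK)
  refine ⟨Finset.univ.map ⟨ι, hι⟩, fun i => p (e.symm i), by simp, ?_, ?_⟩
  · exact (reach_diagOp_relabel (Equiv.refl Unit) e _).trans (reach_bobDist_diagOp fun i => p (e.symm i))
  · rw [Finset.sum_map, ← Finset.sum_coe_sort T]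
    refine Finset.sum_congr rfl fun t _ => ?_
    simp [← he t]

theorem diagOp_eq_sum_single (P : A × B → ℝ) :
    diagOp P = ∑ i, (P i : ℂ) • Matrix.single i i (1 : ℂ) := by
  rw [diagOp, ← Matrix.sum_single_eq_diagonal]
  exact Finset.sum_congr rfl fun i _ => by simp [Matrix.smul_single]

theorem isState_single (i : A × B) : IsState (Matrix.single i i (1 : ℂ) : BiOp A B) := by
  have h : (Matrix.single i i (1 : ℂ) : BiOp A B) = diagOp (Pi.single i 1) := by
    rw [diagOp, ← Matrix.diagonal_single]
    congr 1
    funext j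
    by_cases hj : j = i
    · subst hj; simp
    · simp [hj]
  rw [h]
  refine isState_diagOp ⟨fun j => ?_, by simp⟩
  by_cases hj : j = i
  · subst hj; simp
  · simp [hj]

theorem IsLinearMap.map_sum_smul {I V W : Type} [Fintype I] [AddCommGroup V] [Module ℂ V]
    [AddCommGroup W] [Module ℂ W] {f : V → W} (hf : IsLinearMap ℂ f) (c : I → ℂ) (v : I → V) :
    f (∑ i, c i • v i) = ∑ i, c i • f (v i) :=
  (map_sum (hf.mk' f) (fun i => c i • v i) Finset.univ).trans
    (Finset.sum_congr rfl fun i _ => hf.map_smul (c i) (v i))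

/-- Blank registers can be used by a protocol on a further system, which restores them. -/
theorem YieldsBlanks.tensor {σ : BiOp A B} {τ : BiOp C D} (hσ : IsState σ) (hτ : IsState τ) {e₀ : E}
    {h w w' : ℝ} (hY : YieldsBlanks σ e₀ h w) {P' : E × (J' × E) → ℝ} {G' : Finset J'}
    (hr : Reach (LocalInfo.tensor (Matrix.single (e₀, e₀) (e₀, e₀) 1) τ) (diagOp P'))
    (hw : 0 ≤ w) (hw' : 0 ≤ w') (hG' : w' ≤ ∑ j ∈ G', P' (e₀, (j, e₀))) :
    YieldsBlanks (LocalInfo.tensor σ τ) e₀ (h + Real.logb 2 G'.card) (w * w') := by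
  obtain ⟨J, _, _, G, P, hP, hG, hGw⟩ := hY
  have hPd : IsDist P := (hP.isState hσ).isDist_of_diagOp
  refine (hP.tensor_left τ).yieldsBlanks ?_
  obtain ⟨Λ, hΛ, eΛ⟩ := hr
  obtain ⟨Λ', hΛ', eΛ'⟩ := hΛ.exists_tensor Unit J
  -- Bob's leftover `J` is set aside as a spectator while the protocol acts on the registers and
  -- `τ`; `r₂` then joins it to the new leftover `J'`.
  let r₁ : (J × E) × D ≃ (E × D) × J :=
    ⟨fun x => ((x.1.2, x.2), x.1.1), fun x => ((x.2, x.1.1), x.1.2), fun _ => rfl, fun _ => rfl⟩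
  let r₂ : (J' × E) × J ≃ (J × J') × E :=
    ⟨fun x => ((x.2, x.1.1), x.1.2), fun x => ((x.1.2, x.2), x.1.1), fun _ => rfl, fun _ => rfl⟩
  have c₁ := IsCLOCC.relabel (Equiv.prodPUnit.{0} (E × C)).symm r₁
  have c₂ := IsCLOCC.relabel (Equiv.prodPUnit.{0} E) r₂
  have c := c₂.comp (hΛ'.comp c₁)
  set Φ := relabel (Equiv.prodPUnit.{0} E) r₂ ∘ Λ' ∘ relabel (Equiv.prodPUnit.{0} (E × C)).symm r₁
  have hΦ : ∀ i : E × (J × E), Φ (LocalInfo.tensor (Matrix.single i i 1) τ) =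
      relabel (Equiv.prodPUnit.{0} E) r₂ (LocalInfo.tensor
        (Λ (LocalInfo.tensor (Matrix.single (i.1, i.2.2) (i.1, i.2.2) 1) τ))
        (Matrix.single ((), i.2.1) ((), i.2.1) 1)) := by
    rintro ⟨e, j, e'⟩
    simp only [Φ, Function.comp_apply, ← eΛ']
    congr 2
    ext ⟨⟨⟨e1, c1⟩, u1⟩, ⟨⟨e1', d1⟩, j1⟩⟩ ⟨⟨⟨e2, c2⟩, u2⟩, ⟨⟨e2', d2⟩, j2⟩⟩
    simp only [relabel, LocalInfo.tensor, Matrix.of_apply, Matrix.single_apply, Prod.ext_iff, ite_mul,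
      one_mul, zero_mul, mul_ite, mul_one, mul_zero, ← ite_and, r₁, Equiv.coe_fn_symm_mk,
      Equiv.symm_symm, Equiv.prodPUnit_apply]
    exact if_congr (by tauto) rfl rfl
  have hsum : Φ (LocalInfo.tensor (diagOp P) τ) =
      ∑ i, (P i : ℂ) • Φ (LocalInfo.tensor (Matrix.single i i 1) τ) := by
    rw [diagOp_eq_sum_single, IsLinearMap.map_sum_smul (isLinearMap_tensor_left τ),
      IsLinearMap.map_sum_smul c.isLinearMap]
  have hstate : IsState (Φ (LocalInfo.tensor (diagOp P) τ)) :=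
    c.isState (isState_tensor (isState_diagOp hPd) hτ)
  -- By linearity the final diagonal is a mixture over the basis states of the first output. All
  -- terms are nonnegative, and only the one with blank registers and leftover `j` is kept.
  have hge : ∀ j j', P (e₀, (j, e₀)) * P' (e₀, (j', e₀)) ≤
      diagRe (Φ (LocalInfo.tensor (diagOp P) τ)) (e₀, ((j, j'), e₀)) := fun j j' => by
    have h1 : diagRe (Φ (LocalInfo.tensor (diagOp P) τ)) (e₀, ((j, j'), e₀)) =
        ∑ i, P i * diagRe (Φ (LocalInfo.tensor (Matrix.single i i 1) τ)) (e₀, ((j, j'), e₀)) := by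
      simp only [diagRe, hsum, Matrix.sum_apply, Complex.re_sum, Matrix.smul_apply, smul_eq_mul,
        Complex.re_ofReal_mul]
    have h2 : diagRe (Φ (LocalInfo.tensor (Matrix.single (e₀, (j, e₀)) (e₀, (j, e₀)) 1) τ))
        (e₀, ((j, j'), e₀)) = P' (e₀, (j', e₀)) := by
      rw [diagRe, hΦ, eΛ]
      simp [relabel, LocalInfo.tensor, diagOp, r₂]
    rw [h1, ← h2]
    refine Finset.single_le_sum (f := fun i => P i * diagRe
      (Φ (LocalInfo.tensor (Matrix.single i i 1) τ)) (e₀, ((j, j'), e₀)))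
      (fun i _ => mul_nonneg (hPd.nonneg i) ?_) (Finset.mem_univ (e₀, (j, e₀)))
    exact (c.isState (isState_tensor (isState_single i) hτ)).isDist_diagRe.nonneg _
  refine ⟨J × J', inferInstance, inferInstance, G ×ˢ G', _,
    Reach.trans ⟨Φ, c, rfl⟩ (reach_dephase hstate), ?_, ?_⟩
  · rw [Finset.card_product, Nat.cast_mul]
    -- Empty sets are treated apart: `Real.logb 2 0 = 0`, and the logarithm of the product does not
    -- split.
    by_cases h0 : (G.card : ℝ) = 0
    · rw [h0] at hG ⊢
      have : 0 ≤ Real.logb 2 G'.card := by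
        rcases Nat.eq_zero_or_pos G'.card with h | h
        · simp [h]
        · exact Real.logb_nonneg one_lt_two (by exact_mod_cast h)
      simp only [Real.logb_zero, zero_mul] at hG ⊢
      linarith
    by_cases h0' : (G'.card : ℝ) = 0
    · rw [h0']
      have : 0 ≤ Real.logb 2 G.card :=
        Real.logb_nonneg one_lt_two (by
          exact_mod_cast Nat.pos_of_ne_zero fun h => h0 (by exact_mod_cast h))
      simp only [Real.logb_zero, mul_zero]
      linarith
    rw [Real.logb_mul h0 h0']
    linarith
  · rw [Finset.sum_product]
    calc w * w' ≤ (∑ j ∈ G, P (e₀, (j, e₀))) * ∑ j' ∈ G', P' (e₀, (j', e₀)) :=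
          mul_le_mul hGw hG' hw' (hw.trans hGw)
      _ = ∑ j ∈ G, ∑ j' ∈ G', P (e₀, (j, e₀)) * P' (e₀, (j', e₀)) := Finset.sum_mul_sum _ _ _ _
      _ ≤ _ := Finset.sum_le_sum fun j _ => Finset.sum_le_sum fun j' _ => hge j j'

/-- The information obtained from a state that yields blank registers. -/
theorem YieldsBlanks.le_locInfo {σ : BiOp A B} (hσ : IsState σ) {e₀ : E} {h w : ℝ}
    (hY : YieldsBlanks σ e₀ h w) :
    w * Real.logb 2 (Fintype.card A * Fintype.card B) - h - 1 ≤ locInfo σ := by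
  obtain ⟨J, _, _, G, P, hP, hG, hGw⟩ := hY
  have hPd : IsDist P := (hP.isState hσ).isDist_of_diagOp
  have h1 := (hP.trans (reach_diagOp_bobDist hPd)).le_locInfo hσ
  have hinj : Function.Injective fun j : J => ((e₀, (j, e₀)) : E × (J × E)) := fun _ _ h => by
    simpa using h
  have h0 : 0 ≤ h := by
    rcases Nat.eq_zero_or_pos G.card with h' | h'
    · simpa [h'] using hG
    · exact (Real.logb_nonneg one_lt_two (by exact_mod_cast h')).trans hG
  have h2 := hPd.shannon_le_of_concentrated (G.map ⟨_, hinj⟩) (w := w) (h := h)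
    (by simpa using hG) (by simpa using hGw) h0
  have hc : (Fintype.card A : ℝ) * Fintype.card B = Fintype.card (E × (J × E)) := by
    rw [Fintype.card_prod E]
    exact_mod_cast hP.card_eq
  rw [← hc] at h2
  linarith

end Recycling

/-! ### The dichotomy: maximally mixed or locally informative. -/

section Rotation

variable {A B I : Type} [Fintype A] [DecidableEq A] [Fintype B] [DecidableEq B] [Fintype I]
  [DecidableEq I]

theorem exists_unitary_col {φ : EuclideanSpace ℂ I} (hφ : ‖φ‖ = 1) (i₀ : I) :
    ∃ W : Matrix.unitaryGroup I ℂ, ∀ i, (W : Matrix I I ℂ) i i₀ = φ i := by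
  have hv : Orthonormal ℂ (({i₀} : Set I).domRestrict fun _ => φ) := by
    refine ⟨fun _ => hφ, fun i j h => absurd (Subsingleton.elim i j) h⟩
  obtain ⟨b, hb⟩ := hv.exists_orthonormalBasis_extension_of_card_eq (by simp)
  refine ⟨⟨_, (EuclideanSpace.basisFun I ℂ).toMatrix_orthonormalBasis_mem_unitary b⟩, fun i => ?_⟩
  simp [Module.Basis.toMatrix_apply, hb i₀ rfl]

/-- Over ℂ the quadratic form determines the operator, by polarisation; scaling reduces it to unit
vectors. -/
theorem matrix_eq_zero_of_forall_unit {N : Matrix I I ℂ}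
    (h : ∀ x : EuclideanSpace ℂ I, ‖x‖ = 1 → ∑ i, ∑ j, star (x i) * N i j * x j = 0) : N = 0 := by
  have h1 : ∀ x : EuclideanSpace ℂ I, inner ℂ (Matrix.toEuclideanLin N x) x = 0 := fun x => by
    have key : ∀ x : EuclideanSpace ℂ I, inner ℂ x (Matrix.toEuclideanLin N x) =
        ∑ i, ∑ j, star (x i) * N i j * x j := fun x => by
      simp only [PiLp.inner_apply, Matrix.toLpLin_apply, Matrix.mulVec, dotProduct,
        RCLike.inner_apply, Finset.sum_mul]
      refine Finset.sum_congr rfl fun i _ => Finset.sum_congr rfl fun j _ => ?_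
      simp only [starRingEnd_apply]
      ring
    rw [← inner_conj_symm, map_eq_zero]
    by_cases hx : x = 0
    · simp [hx]
    have hn : ‖x‖ ≠ 0 := norm_ne_zero_iff.mpr hx
    have h2 := h ((‖x‖⁻¹ : ℂ) • x) (by
      rw [norm_smul, norm_inv, Complex.norm_real, norm_norm, inv_mul_cancel₀ hn])
    rw [← key, map_smul, inner_smul_left, inner_smul_right] at h2
    simpa [hn] using h2
  have h2 := (inner_map_self_eq_zero (Matrix.toEuclideanLin N)).mp h1
  simpa using h2

/-- The entry at `(a₀, b₀)` runs through the expectations in all product unit vectors. Polarisation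
for Alice and then for Bob recovers every entry of `M`. -/
theorem eq_zero_of_forall_localUnitary {M : BiOp A B} (a₀ : A) (b₀ : B)
    (h : ∀ U V, localUnitary U V M (a₀, b₀) (a₀, b₀) = 0) : M = 0 := by
  have h1 : ∀ (u : EuclideanSpace ℂ A) (v : EuclideanSpace ℂ B), ‖u‖ = 1 → ‖v‖ = 1 →
      ∑ a, ∑ a', star (u a) * (∑ b, ∑ b', star (v b) * M (a, b) (a', b') * v b') * u a' = 0 := by
    intro u v hu hv
    obtain ⟨U, hU⟩ := exists_unitary_col hu a₀
    obtain ⟨V, hV⟩ := exists_unitary_col hv b₀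
    rw [← h (star U) (star V)]
    simp only [localUnitary, Matrix.mul_apply, Matrix.conjTranspose_apply, Matrix.kroneckerMap_apply,
      Unitary.coe_star, Matrix.star_apply, hU, hV, star_mul', star_star, Fintype.sum_prod_type,
      Finset.mul_sum, Finset.sum_mul]
    rw [Finset.sum_comm]
    refine Finset.sum_congr rfl fun a' _ => ?_
    simp_rw [Finset.sum_comm (s := (Finset.univ : Finset B)) (t := (Finset.univ : Finset A))]
    refine Finset.sum_congr rfl fun a _ => ?_
    rw [Finset.sum_comm]
    refine Finset.sum_congr rfl fun b' _ => Finset.sum_congr rfl fun b _ => ?_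
    ring
  have h2 : ∀ v : EuclideanSpace ℂ B, ‖v‖ = 1 →
      (Matrix.of fun a a' => ∑ b, ∑ b', star (v b) * M (a, b) (a', b') * v b') = 0 := fun v hv =>
    matrix_eq_zero_of_forall_unit fun u hu => h1 u v hu hv
  ext ⟨a, b⟩ ⟨a', b'⟩
  have h3 : (Matrix.of fun b b' => M (a, b) (a', b')) = 0 :=
    matrix_eq_zero_of_forall_unit fun v hv => congrFun (congrFun (h2 v hv) a) a'
  exact congrFun (congrFun h3 b) b'

/-- A state that is not maximally mixed has positive information locally. -/
theorem exists_bobDist_shannon_lt {ρ : BiOp A B} (hρ : IsState ρ)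
    (h : ρ ≠ ((Fintype.card (A × B) : ℝ)⁻¹ : ℂ) • (1 : BiOp A B)) :
    ∃ p : A × B → ℝ, IsDist p ∧ Reach ρ (bobDist p) ∧
      shannon p < Real.logb 2 (Fintype.card (A × B)) := by
  obtain ⟨i₀⟩ := hρ.isDist_diagRe.nonempty
  set c : ℂ := ((Fintype.card (A × B) : ℝ)⁻¹ : ℂ) with hc
  -- Unless ρ is c times the identity, some local rotation makes a diagonal entry differ from 1/d,
  -- so the dephased distribution is not uniform.
  have : ∃ U V, localUnitary U V (ρ - c • (1 : BiOp A B)) i₀ i₀ ≠ 0 := by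
    by_contra hne
    push Not at hne
    exact h (sub_eq_zero.mp (eq_zero_of_forall_localUnitary i₀.1 i₀.2 hne))
  obtain ⟨U, V, hUV⟩ := this
  have hcl : IsCLOCC (localUnitary U V) := IsCLOCC.localUnitary U V
  have hs := hcl.isState hρ
  refine ⟨_, hs.isDist_diagRe, Reach.trans ⟨_, hcl, rfl⟩ (reach_collect hs),
    hs.isDist_diagRe.shannon_lt_logb_card (x₀ := i₀) fun he => hUV ?_⟩
  have h1 := (hcl.isLinearMap.mk' _).map_sub ρ (c • (1 : BiOp A B))
  have h2 := hcl.isLinearMap.map_smul c (1 : BiOp A B)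
  simp only [IsLinearMap.mk'_apply] at h1
  rw [h1, h2, hcl.map_one, Matrix.sub_apply, ← posSemidef_diagRe hs.1, he]
  simp [hc]

/-- Ancillas do not help for the maximally mixed state. -/
theorem logb_card_le_shannon_of_maximallyMixed {A₁ B₁ J : Type} [Fintype A₁] [DecidableEq A₁]
    [Fintype B₁] [DecidableEq B₁] [Fintype J] [DecidableEq J] {f : A → A₁} {g : B → B₁}
    (hf : Function.Injective f) (hg : Function.Injective g) {p : J → ℝ} (hp : IsDist p)
    (hr : Reach (embed f g (((Fintype.card (A × B) : ℝ)⁻¹ : ℂ) • (1 : BiOp A B))) (bobDist p)) :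
    Real.logb 2 (Fintype.card (A × B)) ≤ shannon p := by
  refine hp.le_shannon_of_le fun j => ?_
  set d : ℝ := (Fintype.card (A × B) : ℝ)⁻¹ with hd
  obtain ⟨Λ, hΛ, e⟩ := hr
  -- The embedded identity is the projection `K * Kᴴ`, hence at most 1. A positive unital map keeps
  -- this bound, so no probability at the output exceeds 1/d.
  have hemb : (1 - embed f g (1 : BiOp A B)).PosSemidef := by
    set K := inclusion f ⊗ₖ inclusion g
    have hK : Kᴴ * K = 1 := by
      rw [Matrix.conjTranspose_kronecker, ← Matrix.mul_kronecker_mul,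
        inclusion_conjTranspose_mul_self hf, inclusion_conjTranspose_mul_self hg,
        Matrix.one_kronecker_one]
    have : 1 - embed f g (1 : BiOp A B) = (1 - K * Kᴴ) * (1 - K * Kᴴ)ᴴ := by
      have h3 : K * Kᴴ * (K * Kᴴ) = K * Kᴴ := by
        rw [Matrix.mul_assoc, ← Matrix.mul_assoc Kᴴ, hK, Matrix.one_mul]
      simp only [embed, Matrix.mul_one, Matrix.conjTranspose_sub, Matrix.conjTranspose_one,
        Matrix.conjTranspose_mul, Matrix.conjTranspose_conjTranspose, Matrix.mul_sub,
        Matrix.sub_mul, Matrix.one_mul]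
      rw [h3]
      abel
    rw [this]
    exact Matrix.posSemidef_self_mul_conjTranspose _
  have h1 := hΛ.posSemidef hemb
  have h2 := (hΛ.isLinearMap.mk' _).map_sub 1 (embed f g (1 : BiOp A B))
  simp only [IsLinearMap.mk'_apply] at h2
  rw [h2, hΛ.map_one] at h1
  have h3 : bobDist p = (d : ℂ) • Λ (embed f g (1 : BiOp A B)) := by
    rw [← e, ← hΛ.isLinearMap.map_smul, ← (isLinearMap_embed f g).map_smul]
    simp [hd]
  have h4 := Complex.nonneg_iff.mp (h1.diag_nonneg (i := ((), j)))
  have h5 := congrArg Complex.re (congrFun (congrFun h3 ((), j)) ((), j))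
  simp only [bobDist, diagOp, Matrix.diagonal_apply_eq, Complex.ofReal_re, Matrix.smul_apply,
    smul_eq_mul, Complex.re_ofReal_mul] at h5
  simp only [Matrix.sub_apply, Matrix.one_apply_eq, Complex.sub_re, Complex.one_re] at h4
  have hd0 : 0 ≤ d := by positivity
  rw [h5]
  nlinarith [h4.1]

end Rotation

/-! ### From arbitrary pure ancillas to registers built of copies of the system space. -/

section Registers

variable {A B A₁ B₁ C D J : Type} [Fintype A] [DecidableEq A] [Fintype B] [DecidableEq B]
    [Fintype A₁] [DecidableEq A₁] [Fintype B₁] [DecidableEq B₁] [Fintype C] [DecidableEq C]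
    [Fintype D] [DecidableEq D] [Fintype J] [DecidableEq J]

theorem diagRe_embed {f : A → A₁} {g : B → B₁} (hf : Function.Injective f)
    (hg : Function.Injective g) (ρ : BiOp A B) (i : A × B) :
    diagRe (embed f g ρ) (Prod.map f g i) = diagRe ρ i := by
  rw [diagRe, embed_apply, diagRe, Finset.sum_eq_single i, Finset.sum_eq_single i]
  · simp
  · intro l _ hl
    simp [(hf.prodMap hg).eq_iff, hl.symm]
  · simp
  · intro l _ hl
    simp [(hf.prodMap hg).eq_iff, hl.symm]
  · simp

theorem diagRe_embed_of_notMem {f : A → A₁} {g : B → B₁} (ρ : BiOp A B) {i : A₁ × B₁}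
    (hi : i ∉ Set.range (Prod.map f g)) : diagRe (embed f g ρ) i = 0 := by
  rw [diagRe, embed_apply, Finset.sum_eq_zero, Complex.zero_re]
  exact fun k _ => Finset.sum_eq_zero fun l _ => if_neg fun h => hi ⟨k, h.1.symm⟩

theorem isState_embed {f : A → A₁} {g : B → B₁} (hf : Function.Injective f)
    (hg : Function.Injective g) {ρ : BiOp A B} (hρ : IsState ρ) : IsState (embed f g ρ) := by
  refine ⟨hρ.1.mul_mul_conjTranspose_same _, ?_⟩
  rw [embed, Matrix.trace_mul_comm, ← Matrix.mul_assoc, Matrix.conjTranspose_kronecker,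
    ← Matrix.mul_kronecker_mul, inclusion_conjTranspose_mul_self hf,
    inclusion_conjTranspose_mul_self hg, Matrix.one_kronecker_one, Matrix.one_mul, hρ.2]

/-- A protocol with pure ancillas can be replaced by one with blank registers whose dimension is a
power of the dimension of the system. -/
theorem exists_register_protocol {ρ : BiOp A B} (hρ : IsState ρ) (hd : 2 ≤ Fintype.card (A × B))
    {f : A → A₁} {g : B → B₁} (hf : Function.Injective f) (hg : Function.Injective g) {p : J → ℝ}
    (hr : Reach (embed f g ρ) (bobDist p)) :
    ∃ (M : ℕ) (e : Fin M → A × B) (q : ((Fin M → A × B) × A) × ((Fin M → A × B) × B) → ℝ),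
      IsDist q ∧ shannon q = shannon p ∧
      Reach (tensor (Matrix.single (e, e) (e, e) 1) ρ) (bobDist q) := by
  obtain ⟨i₀⟩ := hρ.isDist_diagRe.nonempty
  obtain ⟨Λ, hΛ, e⟩ := hr
  obtain ⟨M₀, hM₀⟩ := hΛ.exists_simulation hd
  -- Large enough for the simulation and, since d^M > M, for `A₁` and `B₁` to fit into the enlarged
  -- local spaces.
  set M := M₀ + Fintype.card A₁ + Fintype.card B₁
  have hA := hρ.card_pos.1
  have hB := hρ.card_pos.2
  have hcA : Fintype.card ((Fin M → A × B) × A) = Fintype.card A * Fintype.card (A × B) ^ M := by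
    rw [Fintype.card_prod, Fintype.card_fun, Fintype.card_fin, mul_comm]
  have hcB : Fintype.card ((Fin M → A × B) × B) = Fintype.card B * Fintype.card (A × B) ^ M := by
    rw [Fintype.card_prod, Fintype.card_fun, Fintype.card_fin, mul_comm]
  have hM : M < Fintype.card (A × B) ^ M := Nat.lt_pow_self hd
  obtain ⟨F, hF⟩ := exists_injective_of_card_le (I := A₁) (K := (Fin M → A × B) × A) (by
    rw [hcA]; exact (by omega : _ ≤ Fintype.card (A × B) ^ M).trans (Nat.le_mul_of_pos_left _ hA))
  obtain ⟨G, hG⟩ := exists_injective_of_card_le (I := B₁) (K := (Fin M → A × B) × B) (by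
    rw [hcB]; exact (by omega : _ ≤ Fintype.card (A × B) ^ M).trans (Nat.le_mul_of_pos_left _ hB))
  obtain ⟨f', g', hf', hg', Λ', hΛ', e'⟩ :=
    hM₀ M (by omega) _ _ _ _ hA hB hcA hcB F G hF hG
  have h1 := e' (embed f g ρ)
  rw [e, embed_embed] at h1
  have hst : IsState (embed f' g' (bobDist p)) := by
    rw [← h1]
    exact hΛ'.isState (isState_embed (hF.comp hf) (hG.comp hg) hρ)
  refine ⟨M, fun _ => i₀, _, hst.isDist_diagRe, ?_, ?_⟩
  · rw [shannon_extend (p := fun i : Unit × J => p i.2) (hf'.prodMap hg')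
      (fun i => (diagRe_embed hf' hg' _ i).trans (by rw [bobDist, diagRe_diagOp]))
      fun y hy => diagRe_embed_of_notMem _ hy]
    simp [shannon, Fintype.sum_prod_type]
  · rw [tensor_single_embed]
    exact (reach_embed_of_card_eq (Prod.mk_right_injective _) (Prod.mk_right_injective _)
      (hF.comp hf) (hG.comp hg) rfl rfl ρ).trans (Reach.trans ⟨Λ', hΛ', h1⟩ (reach_collect hst))

theorem reach_tensorPow_tensor (σ : BiOp C D) (ρ : BiOp A B) (n : ℕ) :
    Reach (tensor (tensorPow n σ) (tensorPow n ρ)) (tensorPow n (tensor σ ρ)) := by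
  convert reach_relabel (Equiv.arrowProdEquivProdArrow (Fin n) (fun _ => C) (fun _ => A)).symm
    (Equiv.arrowProdEquivProdArrow (Fin n) (fun _ => D) (fun _ => B)).symm _ using 1
  ext ⟨a, b⟩ ⟨a', b'⟩
  simp [relabel, tensor, tensorPow, Finset.prod_mul_distrib, Equiv.arrowProdEquivProdArrow]

theorem tensorPow_single (a : A) (b : B) (n : ℕ) :
    tensorPow n (Matrix.single (a, b) (a, b) (1 : ℂ)) =
      Matrix.single (fun _ => a, fun _ => b) (fun _ => a, fun _ => b) (1 : ℂ) := by
  ext ⟨i, i'⟩ ⟨j, j'⟩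
  simp only [tensorPow, Matrix.of_apply, Matrix.single_apply, Finset.prod_ite_zero,
    Finset.prod_const_one, Prod.ext_iff, funext_iff, Finset.mem_univ, true_implies]
  exact if_congr ⟨fun h => ⟨⟨fun k => (h k).1.1, fun k => (h k).1.2⟩, fun k => (h k).2.1,
    fun k => (h k).2.2⟩, fun h k => ⟨⟨h.1.1 k, h.1.2 k⟩, h.2.1 k, h.2.2 k⟩⟩ rfl rfl

theorem Reach.register_pow {E : Type} [Fintype E] [DecidableEq E] {ρ : BiOp A B} {e : E}
    {q : J → ℝ} (hr : Reach (LocalInfo.tensor (Matrix.single (e, e) (e, e) 1) ρ) (bobDist q))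
    (n : ℕ) :
    Reach (LocalInfo.tensor (Matrix.single ((fun _ => e : Fin n → E), (fun _ => e : Fin n → E))
      (fun _ => e, fun _ => e) 1) (LocalInfo.tensorPow n ρ))
      (bobDist fun x : Fin n → J => ∏ i, q (x i)) := by
  rw [← tensorPow_single]
  exact (reach_tensorPow_tensor _ ρ n).trans (hr.bobDist_pow n)

end Registers

/-! ### Amortising the cost of the registers over many rounds. -/

section Catalysis

variable {A B A₁ B₁ E J : Type} [Fintype A] [DecidableEq A] [Fintype B] [DecidableEq B]
    [Fintype A₁] [DecidableEq A₁] [Fintype B₁] [DecidableEq B₁] [Fintype E] [DecidableEq E]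
    [Fintype J] [DecidableEq J]

theorem YieldsBlanks.mono {σ : BiOp A B} {e₀ : E} {h h' w w' : ℝ} (hY : YieldsBlanks σ e₀ h w)
    (hh : h ≤ h') (hw : w' ≤ w) : YieldsBlanks σ e₀ h' w' := by
  obtain ⟨J, _, _, G, P, hP, hG, hGw⟩ := hY
  exact ⟨J, _, _, G, P, hP, hG.trans hh, hw.trans hGw⟩

theorem le_pow_of_le_rpow {d n : ℕ} {m t : ℝ} (hd : 1 ≤ d) (hm : m ≤ (2 : ℝ) ^ t)
    (ht : t ≤ n * Real.logb 2 d) : m ≤ (d : ℝ) ^ n := by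
  refine hm.trans ((Real.rpow_le_rpow_of_exponent_le one_le_two ht).trans_eq ?_)
  have hd0 : (0 : ℝ) < d := by exact_mod_cast hd
  rw [mul_comm, Real.rpow_mul two_pos.le, Real.rpow_logb two_pos (by norm_num) hd0,
    Real.rpow_natCast]

theorem logb_natCast_le_of_le_rpow {m : ℕ} {t : ℝ} (ht : 0 ≤ t) (hm : (m : ℝ) ≤ (2 : ℝ) ^ t) :
    Real.logb 2 m ≤ t := by
  rcases Nat.eq_zero_or_pos m with rfl | h
  · simpa using ht
  · rwa [Real.logb_le_iff_le_rpow one_lt_two (by exact_mod_cast h)]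

/-- Blank registers can be distilled from a number of copies proportional to their size. -/
theorem eventually_yieldsBlanks_seed {ρ : BiOp A B} {p₀ : A × B → ℝ} (hp₀ : IsDist p₀)
    (hr₀ : Reach ρ (bobDist p₀)) (hlt : shannon p₀ < Real.logb 2 (Fintype.card (A × B))) (M : ℕ)
    (e : Fin M → A × B) :
    ∃ C : ℕ, ∀ δ > 0, ∀ᶠ N : ℕ in atTop, YieldsBlanks (tensorPow (C * N) ρ)
      (fun _ => e : Fin N → Fin M → A × B) (C * N * Real.logb 2 (Fintype.card (A × B))) (1 - δ) := by
  have hd : 1 ≤ Fintype.card (A × B) := Fintype.card_pos_iff.mpr hp₀.nonempty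
  set L := Real.logb 2 (Fintype.card (A × B)) with hL
  set η := (L - shannon p₀) / 2 with hη
  have hη0 : 0 < η := by rw [hη]; linarith
  -- After compression, C·N copies occupy C·N·(L − η) bits, which must fit into (C − 2M)·N systems
  -- of dimension d; this needs 2ML ≤ Cη. The freed 2M·N systems are the two registers. The summand
  -- 2M + 1 keeps `C - 2 * M` positive.
  obtain ⟨C, hC⟩ := exists_nat_gt (2 * M * L / η + (2 * M + 1))
  have hL0 : 0 ≤ L := Real.logb_nonneg one_lt_two (by exact_mod_cast hd)
  have hq0 : 0 ≤ 2 * M * L / η := by positivity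
  have hCM : 2 * M + 1 ≤ C := by
    have : ((2 * M + 1 : ℕ) : ℝ) ≤ C := by push_cast; linarith
    exact_mod_cast this
  have hCη : 2 * M * L ≤ C * η := by
    have : 2 * M * L / η ≤ C := by linarith
    rwa [div_le_iff₀ hη0] at this
  refine ⟨C, fun δ hδ => ?_⟩
  have ht : Tendsto (fun N : ℕ => C * N) atTop atTop :=
    tendsto_id.const_mul_atTop' (by omega : 0 < C)
  filter_upwards [ht.eventually (hp₀.exists_typical hη0 hδ)] with N hN
  obtain ⟨T, hT, hTw⟩ := hN
  have hexp : ((C * N : ℕ) : ℝ) * (shannon p₀ + η) ≤ (((C - 2 * M) * N : ℕ) : ℝ) * L := by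
    rw [Nat.cast_mul, Nat.cast_mul, Nat.cast_sub (by omega)]
    push_cast
    have : shannon p₀ + η = L - η := by rw [hη]; ring
    rw [this]
    have hN0 : (0 : ℝ) ≤ N := Nat.cast_nonneg N
    nlinarith
  obtain ⟨G, P, hG, hP, hPw⟩ := exists_compression (J := Fin ((C - 2 * M) * N) → A × B)
    (fun x : Fin (C * N) → A × B => ∏ i, p₀ (x i)) T (fun _ => e : Fin N → Fin M → A × B)
    (by
      simp only [Fintype.card_fun, Fintype.card_fin]
      rw [← pow_mul, ← pow_add, ← pow_add]
      congr 1
      obtain ⟨c, rfl⟩ := Nat.exists_eq_add_of_le (by omega : 2 * M ≤ C)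
      rw [Nat.add_sub_cancel_left]
      ring)
    (by
      rw [Fintype.card_fun, Fintype.card_fin]
      exact_mod_cast le_pow_of_le_rpow hd hT hexp)
  refine ⟨_, _, _, G, P, (hr₀.bobDist_pow _).trans hP, ?_, hPw ▸ hTw⟩
  rw [hG]
  refine (logb_natCast_le_of_le_rpow (mul_nonneg (Nat.cast_nonneg _)
    (add_nonneg hp₀.shannon_nonneg hη0.le)) hT).trans ?_
  -- The leftover is bounded crudely by C·N·L: the information in the seed outside its registers is
  -- written off.
  push_cast
  refine mul_le_mul_of_nonneg_left ?_ (by positivity)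
  rw [hη]
  linarith

/-- One round of the register protocol on `N` copies, which restores the registers. -/
theorem eventually_exists_round {Q : Type} [Fintype Q] [DecidableEq Q] {ρ : BiOp A B}
    (hρ : IsState ρ) {M : ℕ} {e : Fin M → A × B}
    (hQ : Fintype.card Q = Fintype.card (A × B) ^ (2 * M + 1)) {q : Q → ℝ} (hq : IsDist q)
    (hr : Reach (tensor (Matrix.single (e, e) (e, e) 1) ρ) (bobDist q)) {ε : ℝ} (hε : 0 < ε)
    (hle : shannon q + ε ≤ Real.logb 2 (Fintype.card (A × B))) {δ : ℝ} (hδ : 0 < δ) :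
    ∀ᶠ N : ℕ in atTop, ∃ (G : Finset (Fin N → A × B))
      (P : (Fin N → Fin M → A × B) × ((Fin N → A × B) × (Fin N → Fin M → A × B)) → ℝ),
      Reach (tensor (Matrix.single ((fun _ => e : Fin N → Fin M → A × B),
        (fun _ => e : Fin N → Fin M → A × B)) (fun _ => e, fun _ => e) 1) (tensorPow N ρ))
        (diagOp P) ∧
      Real.logb 2 G.card ≤ N * (shannon q + ε) ∧ 1 - δ ≤ ∑ j ∈ G, P (fun _ => e, (j, fun _ => e)) := by
  have hd : 1 ≤ Fintype.card (A × B) := Fintype.card_pos_iff.mpr hρ.isDist_diagRe.nonempty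
  filter_upwards [hq.exists_typical hε hδ] with N hN
  obtain ⟨T, hT, hTw⟩ := hN
  obtain ⟨G, P, hG, hP, hPw⟩ := exists_compression (J := Fin N → A × B)
    (fun x : Fin N → Q => ∏ i, q (x i)) T (fun _ => e : Fin N → Fin M → A × B)
    -- The N outputs have d^((2M+1)N) values, which are exactly two registers of d^(MN) values each
    -- and a leftover of d^N; the typical set fits into the leftover because H(q) + ε ≤ L.
    (by
      simp only [Fintype.card_fun, Fintype.card_fin, hQ]
      ring)
    (by
      rw [Fintype.card_fun, Fintype.card_fin]
      exact_mod_cast le_pow_of_le_rpow hd hT (mul_le_mul_of_nonneg_left hle (Nat.cast_nonneg N)))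
  refine ⟨G, P, (hr.register_pow N).trans hP, ?_, hPw ▸ hTw⟩
  rw [hG]
  exact logb_natCast_le_of_le_rpow (mul_nonneg (Nat.cast_nonneg _)
    (add_nonneg hq.shannon_nonneg hε.le)) hT

/-- Each further round takes N fresh copies and gives the registers back, so `C` is chosen before
`k`. For fixed `k` the losses of weight are kept small by taking N large. -/
theorem eventually_yieldsBlanks {Q : Type} [Fintype Q] [DecidableEq Q] {ρ : BiOp A B}
    (hρ : IsState ρ) {p₀ : A × B → ℝ} (hp₀ : IsDist p₀)
    (hr₀ : Reach ρ (bobDist p₀)) (hlt : shannon p₀ < Real.logb 2 (Fintype.card (A × B))) {M : ℕ}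
    {e : Fin M → A × B} (hQ : Fintype.card Q = Fintype.card (A × B) ^ (2 * M + 1))
    {q : Q → ℝ} (hq : IsDist q)
    (hr : Reach (tensor (Matrix.single (e, e) (e, e) 1) ρ) (bobDist q)) {ε : ℝ} (hε : 0 < ε)
    (hle : shannon q + ε ≤ Real.logb 2 (Fintype.card (A × B))) :
    ∃ C : ℕ, ∀ k : ℕ, ∀ δ > 0, ∀ᶠ N : ℕ in atTop, YieldsBlanks (tensorPow ((C + k) * N) ρ)
      (fun _ => e : Fin N → Fin M → A × B)
      (C * N * Real.logb 2 (Fintype.card (A × B)) + k * N * (shannon q + ε)) (1 - δ) := by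
  obtain ⟨C, hC⟩ := eventually_yieldsBlanks_seed hp₀ hr₀ hlt M e
  refine ⟨C, fun k => ?_⟩
  induction k with
  | zero => simpa using hC
  | succ k ih =>
    intro δ hδ
    -- Chosen so that (1 − δ')² ≥ 1 − δ; the bound by 1 keeps the weights nonnegative.
    set δ' := min (δ / 2) 1
    have hδ' : 0 < δ' := lt_min (by linarith) one_pos
    have hδ1 : δ' ≤ 1 := min_le_right _ _
    have hδ2 : δ' ≤ δ / 2 := min_le_left _ _
    filter_upwards [ih δ' hδ', eventually_exists_round hρ hQ hq hr hε hle hδ'] with N hN hround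
    obtain ⟨G, P, hP, hG, hPw⟩ := hround
    have h1 := hN.tensor (isState_tensorPow hρ _) (isState_tensorPow hρ N) hP (by linarith)
      (by linarith) hPw
    have hn : (C + (k + 1)) * N = (C + k) * N + N := by ring
    rw [hn]
    refine ((reach_tensorPow_add ρ _ N).yieldsBlanks h1).mono ?_ (by nlinarith)
    push_cast
    linarith

theorem logb_card_pow (A B : Type) [Fintype A] [Fintype B] (n : ℕ) :
    Real.logb 2 (Fintype.card (Fin n → A) * Fintype.card (Fin n → B)) =
      n * Real.logb 2 (Fintype.card A * Fintype.card B) := by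
  rw [Fintype.card_fun, Fintype.card_fun, Fintype.card_fin, Nat.cast_pow, Nat.cast_pow, ← mul_pow,
    Real.logb_pow]

/-- A protocol with pure ancillas does not extract more information, net of the ancillas, than can
be extracted per copy from many copies. -/
theorem sub_shannon_le_of_forall_locInfo_le {ρ : BiOp A B} (hρ : IsState ρ) {R : ℝ}
    (hR : ∀ n : ℕ, 1 ≤ n → locInfo (tensorPow n ρ) ≤ n * R) {f : A → A₁} {g : B → B₁}
    (hf : Function.Injective f) (hg : Function.Injective g) {p : J → ℝ}
    (hr : Reach (embed f g ρ) (bobDist p)) :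
    Real.logb 2 (Fintype.card A * Fintype.card B) - shannon p ≤ R := by
  have hp : IsDist p := (hr.isState (isState_embed hf hg hρ)).isDist_of_bobDist
  -- Nonnegativity of R ensures H(p) + ε ≤ L later on, so that the leftover of a round fits into N
  -- systems of dimension d.
  have hR0 : 0 ≤ R := by
    have h1 := hR 1 le_rfl
    have h2 := locInfo_nonneg (isState_tensorPow hρ 1)
    simp only [Nat.cast_one, one_mul] at h1
    linarith
  have hcard : (Fintype.card A : ℝ) * Fintype.card B = (Fintype.card (A × B) : ℝ) := by
    rw [Fintype.card_prod, Nat.cast_mul]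
  rw [hcard]
  set L := Real.logb 2 (Fintype.card (A × B)) with hL
  by_contra hcon
  push Not at hcon
  have hd : 2 ≤ Fintype.card (A × B) := by
    by_contra h
    have h1 : Fintype.card (A × B) = 1 := by
      have := Fintype.card_pos_iff.mpr hρ.isDist_diagRe.nonempty
      omega
    rw [h1] at hL
    simp only [Nat.cast_one, Real.logb_one] at hL
    linarith [hp.shannon_nonneg]
  have hne : ρ ≠ ((Fintype.card (A × B) : ℝ)⁻¹ : ℂ) • (1 : BiOp A B) := by
    rintro rfl
    have := logb_card_le_shannon_of_maximallyMixed hf hg hp hr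
    linarith
  obtain ⟨p₀, hp₀, hr₀, hlt⟩ := exists_bobDist_shannon_lt hρ hne
  obtain ⟨M, e, q, hq, hqp, hrq⟩ := exists_register_protocol hρ hd hf hg hr
  -- Half the assumed excess: each copy used in a round then gains ε over R, while the seed falls
  -- short of R by C·R per unit of N.
  set ε := (L - shannon p - R) / 2 with hεdef
  have hε : 0 < ε := by rw [hεdef]; linarith
  obtain ⟨C, hC⟩ := eventually_yieldsBlanks hρ hp₀ hr₀ hlt
    (by simp only [Fintype.card_fun, Fintype.card_fin, Fintype.card_prod]; ring) hq hrq hε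
    (by rw [hqp]; linarith)
  obtain ⟨k, hk⟩ := exists_nat_gt (C * R / ε)
  rw [div_lt_iff₀ hε] at hk
  have hL0 : 0 ≤ L := Real.logb_nonneg one_lt_two (by exact_mod_cast (by omega : 1 ≤ _))
  -- After division by N the errors are δ(C + k)L from the lost weight and 1/N from the extra bit,
  -- together less than δ·s, which is half of the surplus kε − CR.
  set s : ℝ := (C + k) * L + 1 with hs
  have hs0 : 0 < s := by positivity
  set δ := (k * ε - C * R) / (2 * s) with hδdef
  have hδ : 0 < δ := div_pos (by linarith) (by positivity)
  have hδs : δ * s = (k * ε - C * R) / 2 := by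
    rw [hδdef]
    field_simp
  have hk0 : 0 < C + k := by
    rcases Nat.eq_zero_or_pos k with rfl | h
    · have : 0 ≤ C * R := by positivity
      simp only [Nat.cast_zero, zero_mul] at hk
      linarith
    · omega
  have hinv : ∀ᶠ N : ℕ in atTop, (1 : ℝ) / (N : ℝ) < δ :=
    (tendsto_const_div_atTop_nhds_zero_nat 1).eventually (gt_mem_nhds hδ)
  obtain ⟨N, hN, hNδ, hN1⟩ := ((hC k δ hδ).and (hinv.and (eventually_ge_atTop 1))).exists
  have hN0 : (0 : ℝ) < N := by exact_mod_cast hN1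
  rw [div_lt_iff₀ hN0] at hNδ
  have h1 := (hN.le_locInfo (isState_tensorPow hρ _)).trans
    (hR _ (Nat.mul_pos hk0 hN1))
  rw [logb_card_pow A B, hcard, ← hL, hqp] at h1
  push_cast at h1
  have h2 : L - shannon p - ε - R = ε := by rw [hεdef]; ring
  have h3 : (N : ℝ) * (k * ε - C * R) ≤ N * (δ * s) := by
    have : shannon p = L - ε - R - ε := by linarith
    rw [this] at h1
    rw [hs]
    nlinarith
  have h4 := le_of_mul_le_mul_left h3 hN0
  linarith

end Catalysis

/-! ### Pure ancillas, regularisation and the catalytic quantity. -/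

section Ancilla

variable {A B A' B' A₀ B₀ : Type} [Fintype A] [DecidableEq A] [Fintype B] [DecidableEq B]
    [Fintype A'] [DecidableEq A'] [Fintype B'] [DecidableEq B']
    [Fintype A₀] [DecidableEq A₀] [Fintype B₀] [DecidableEq B₀]

theorem localUnitary_star_localUnitary (U : Matrix.unitaryGroup A ℂ) (V : Matrix.unitaryGroup B ℂ)
    (σ : BiOp A B) : localUnitary (star U) (star V) (localUnitary U V σ) = σ := by
  have h1 : (((star U : Matrix.unitaryGroup A ℂ) : Matrix A A ℂ) ⊗ₖ
      ((star V : Matrix.unitaryGroup B ℂ) : Matrix B B ℂ)) =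
      ((U : Matrix A A ℂ) ⊗ₖ (V : Matrix B B ℂ))ᴴ := by
    rw [Matrix.conjTranspose_kronecker]
    rfl
  rw [localUnitary, localUnitary, h1, Matrix.conjTranspose_conjTranspose, Matrix.mul_assoc,
    Matrix.mul_assoc, conjTranspose_kronecker_mul_self, Matrix.mul_one, ← Matrix.mul_assoc,
    conjTranspose_kronecker_mul_self, Matrix.one_mul]

/-- The pure product state `|φ⟩⟨φ| ⊗ |χ⟩⟨χ|`. -/
def pureProduct (φ : EuclideanSpace ℂ A₀) (χ : EuclideanSpace ℂ B₀) : BiOp A₀ B₀ :=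
  Matrix.of fun i j => (φ i.1 * star (φ j.1)) * (χ i.2 * star (χ j.2))

theorem withAncilla_eq_tensor (ρ : BiOp A B) (φ : EuclideanSpace ℂ A₀) (χ : EuclideanSpace ℂ B₀) :
    withAncilla ρ φ χ = tensor ρ (pureProduct φ χ) := by
  ext i j
  simp only [withAncilla, tensor, pureProduct, Matrix.of_apply, mul_assoc]

theorem exists_localUnitary_single_eq_pureProduct {φ : EuclideanSpace ℂ A₀}
    {χ : EuclideanSpace ℂ B₀} (hφ : ‖φ‖ = 1) (hχ : ‖χ‖ = 1) (a₀ : A₀) (b₀ : B₀) :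
    ∃ U V, localUnitary U V (Matrix.single (a₀, b₀) (a₀, b₀) 1) = pureProduct φ χ := by
  obtain ⟨U, hU⟩ := exists_unitary_col hφ a₀
  obtain ⟨V, hV⟩ := exists_unitary_col hχ b₀
  refine ⟨U, V, ?_⟩
  rw [localUnitary, Matrix.single_eq_single_vecMulVec_single, Matrix.mul_vecMulVec,
    Matrix.vecMulVec_mul]
  ext ⟨a, b⟩ ⟨a', b'⟩
  simp only [Matrix.vecMulVec_apply, Matrix.mulVec_single, Matrix.single_one_vecMul,
    MulOpposite.op_one, one_smul, Matrix.col_apply, Matrix.row_apply, Matrix.conjTranspose_apply,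
    Matrix.kroneckerMap_apply, hU, hV, star_mul', pureProduct, Matrix.of_apply]
  ring

theorem nonempty_of_norm_eq_one {I : Type} [Fintype I] {φ : EuclideanSpace ℂ I} (h : ‖φ‖ = 1) :
    Nonempty I := by
  by_contra hI
  rw [not_nonempty_iff] at hI
  rw [Subsingleton.elim φ 0, norm_zero] at h
  exact zero_ne_one h

variable {φ : EuclideanSpace ℂ A₀} {χ : EuclideanSpace ℂ B₀}

/-- Any pure ancilla is a local unitary away from a blank basis state. -/
theorem reach_embed_withAncilla (hφ : ‖φ‖ = 1) (hχ : ‖χ‖ = 1) (a₀ : A₀) (b₀ : B₀) (ρ : BiOp A B) :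
    Reach (embed (Prod.mk a₀) (Prod.mk b₀) ρ) (withAncilla ρ φ χ) := by
  obtain ⟨U, V, h⟩ := exists_localUnitary_single_eq_pureProduct hφ hχ a₀ b₀
  have hr : Reach (Matrix.single (a₀, b₀) (a₀, b₀) 1) (pureProduct φ χ) :=
    ⟨_, IsCLOCC.localUnitary U V, h⟩
  rw [← tensor_single_embed, withAncilla_eq_tensor]
  exact (hr.tensor_left ρ).trans (reach_tensor_comm _ _)

theorem isState_withAncilla {ρ : BiOp A B} (hρ : IsState ρ) (hφ : ‖φ‖ = 1) (hχ : ‖χ‖ = 1) :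
    IsState (withAncilla ρ φ χ) := by
  obtain ⟨a₀⟩ := nonempty_of_norm_eq_one hφ
  obtain ⟨b₀⟩ := nonempty_of_norm_eq_one hχ
  exact (reach_embed_withAncilla hφ hχ a₀ b₀ ρ).isState
    (isState_embed (Prod.mk_right_injective _) (Prod.mk_right_injective _) hρ)

theorem logb_card_le_locInfo_pureProduct (hφ : ‖φ‖ = 1) (hχ : ‖χ‖ = 1) :
    IsState (pureProduct φ χ) ∧
      Real.logb 2 (Fintype.card A₀) + Real.logb 2 (Fintype.card B₀) ≤
        locInfo (pureProduct φ χ) := by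
  obtain ⟨a₀⟩ := nonempty_of_norm_eq_one hφ
  obtain ⟨b₀⟩ := nonempty_of_norm_eq_one hχ
  obtain ⟨U, V, h⟩ := exists_localUnitary_single_eq_pureProduct hφ hχ a₀ b₀
  have hs : IsState (pureProduct φ χ) := by
    rw [← h]
    exact (IsCLOCC.localUnitary U V).isState (isState_single _)
  have hr : Reach (pureProduct φ χ) (Matrix.single (a₀, b₀) (a₀, b₀) 1) :=
    ⟨_, IsCLOCC.localUnitary (star U) (star V), by rw [← h, localUnitary_star_localUnitary]⟩
  refine ⟨hs, ?_⟩
  have h1 := (hr.trans (reach_collect (isState_single _))).le_locInfo hs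
  have h2 : shannon (diagRe (Matrix.single (a₀, b₀) (a₀, b₀) (1 : ℂ))) = 0 := by
    refine Finset.sum_eq_zero fun i _ => ?_
    rw [diagRe, Matrix.single_apply]
    split_ifs <;> simp
  have hA : (Fintype.card A₀ : ℝ) ≠ 0 := by
    have : Nonempty A₀ := ⟨a₀⟩
    exact_mod_cast Fintype.card_ne_zero
  have hB : (Fintype.card B₀ : ℝ) ≠ 0 := by
    have : Nonempty B₀ := ⟨b₀⟩
    exact_mod_cast Fintype.card_ne_zero
  rwa [h2, sub_zero, Real.logb_mul hA hB] at h1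

/-- The trivial direction: the information of the ancillas can always be extracted separately. -/
theorem locInfo_add_le_withAncilla {ρ : BiOp A B} (hρ : IsState ρ) (hφ : ‖φ‖ = 1) (hχ : ‖χ‖ = 1) :
    locInfo ρ + (Real.logb 2 (Fintype.card A₀) + Real.logb 2 (Fintype.card B₀)) ≤
      locInfo (withAncilla ρ φ χ) := by
  obtain ⟨hs, h⟩ := logb_card_le_locInfo_pureProduct hφ hχ
  rw [withAncilla_eq_tensor]
  exact (add_le_add_right h _).trans (locInfo_add_le_tensor hρ hs)

/-- The bound `R` is left free: the logarithm of the dimension gives finiteness, and the regularised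
limit gives the sharp bound. -/
theorem le_of_mem_catLocInfoSet {ρ : BiOp A B} (hρ : IsState ρ) {R : ℝ}
    (hR : ∀ n : ℕ, 1 ≤ n → locInfo (tensorPow n ρ) ≤ n * R) {x : ℝ} (hx : x ∈ catLocInfoSet ρ) :
    x ≤ R := by
  obtain ⟨A₀, B₀, _, _, _, _, φ, χ, hφ, hχ, rfl⟩ := hx
  obtain ⟨a₀⟩ := nonempty_of_norm_eq_one hφ
  obtain ⟨b₀⟩ := nonempty_of_norm_eq_one hχ
  rw [sub_le_iff_le_add]
  refine locInfo_le_of_forall_bobDist (isState_withAncilla hρ hφ hχ) fun J _ _ p _ hr => ?_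
  have h1 := sub_shannon_le_of_forall_locInfo_le hρ hR (Prod.mk_right_injective _)
    (Prod.mk_right_injective _) ((reach_embed_withAncilla hφ hχ a₀ b₀ ρ).trans hr)
  have h2 := hρ.card_pos
  have h3 := (isState_withAncilla hρ hφ hχ).card_pos
  rw [Fintype.card_prod, Fintype.card_prod] at h3 ⊢
  have hA : (Fintype.card A : ℝ) ≠ 0 := by exact_mod_cast h2.1.ne'
  have hB : (Fintype.card B : ℝ) ≠ 0 := by exact_mod_cast h2.2.ne'
  have hA₀ : (Fintype.card A₀ : ℝ) ≠ 0 := by exact_mod_cast (Nat.pos_of_mul_pos_left h3.1).ne'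
  have hB₀ : (Fintype.card B₀ : ℝ) ≠ 0 := by exact_mod_cast (Nat.pos_of_mul_pos_left h3.2).ne'
  push_cast
  rw [Real.logb_mul hA hB] at h1
  rw [Real.logb_mul (mul_ne_zero hA hA₀) (mul_ne_zero hB hB₀), Real.logb_mul hA hA₀,
    Real.logb_mul hB hB₀]
  linarith

theorem locInfo_tensorPow_le {ρ : BiOp A B} (hρ : IsState ρ) (n : ℕ) :
    locInfo (tensorPow n ρ) ≤ n * Real.logb 2 (Fintype.card A * Fintype.card B) := by
  rw [← logb_card_pow]
  exact locInfo_le (isState_tensorPow hρ n)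

theorem bddAbove_catLocInfoSet {ρ : BiOp A B} (hρ : IsState ρ) : BddAbove (catLocInfoSet ρ) :=
  ⟨_, fun _ => le_of_mem_catLocInfoSet hρ fun n _ => locInfo_tensorPow_le hρ n⟩

theorem catLocInfo_le {ρ : BiOp A B} (hρ : IsState ρ) {R : ℝ}
    (hR : ∀ n : ℕ, 1 ≤ n → locInfo (tensorPow n ρ) ≤ n * R) : catLocInfo ρ ≤ R := by
  refine csSup_le ⟨_, Unit, Unit, inferInstance, inferInstance, inferInstance, inferInstance,
    EuclideanSpace.single () 1, EuclideanSpace.single () 1, by simp, by simp, rfl⟩ fun x hx =>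
    le_of_mem_catLocInfoSet hρ hR hx

theorem sub_le_catLocInfo {ρ : BiOp A B} (hρ : IsState ρ) (hφ : ‖φ‖ = 1) (hχ : ‖χ‖ = 1) :
    locInfo (withAncilla ρ φ χ) -
      (Real.logb 2 (Fintype.card A₀) + Real.logb 2 (Fintype.card B₀)) ≤ catLocInfo ρ :=
  le_csSup (bddAbove_catLocInfoSet hρ) ⟨A₀, B₀, _, _, _, _, φ, χ, hφ, hχ, rfl⟩

theorem locInfo_le_catLocInfo {ρ : BiOp A B} (hρ : IsState ρ) : locInfo ρ ≤ catLocInfo ρ := by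
  have hn : ‖(EuclideanSpace.single () 1 : EuclideanSpace ℂ Unit)‖ = 1 := by simp
  have h1 := locInfo_add_le_withAncilla hρ hn hn
  have h2 := sub_le_catLocInfo hρ hn hn
  linarith

theorem reach_tensorPow_mul (ρ : BiOp A B) (n k : ℕ) :
    Reach (tensorPow (k * n) ρ) (tensorPow k (tensorPow n ρ)) := by
  induction k with
  | zero =>
    rw [Nat.zero_mul]
    exact reach_tensorPow_zero ρ _
  | succ k ih =>
    rw [Nat.succ_mul]
    exact (reach_tensorPow_add ρ _ n).trans <| (ih.tensor (reach_tensorPow_one _)).trans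
      (reach_tensorPow_add' _ k 1)

theorem locInfo_tensorPow_tensorPow_le {ρ : BiOp A B} (hρ : IsState ρ) {r : ℝ}
    (hr : ∀ n : ℕ, 1 ≤ n → locInfo (tensorPow n ρ) ≤ n * r) {n : ℕ} (hn : 1 ≤ n) (k : ℕ)
    (hk : 1 ≤ k) : locInfo (tensorPow k (tensorPow n ρ)) ≤ k * (n * r) := by
  refine ((reach_tensorPow_mul ρ n k).locInfo_le (isState_tensorPow hρ _)).trans
    ((hr _ (Nat.mul_pos hk hn)).trans_eq ?_)
  push_cast
  ring

/-- The tensor power of a vector. -/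
def vecPow (n : ℕ) (φ : EuclideanSpace ℂ A₀) : EuclideanSpace ℂ (Fin n → A₀) :=
  WithLp.toLp 2 fun x => ∏ i, φ (x i)

theorem norm_vecPow (n : ℕ) (hφ : ‖φ‖ = 1) : ‖vecPow n φ‖ = 1 := by
  rw [EuclideanSpace.norm_eq, Real.sqrt_eq_one] at hφ ⊢
  have hd : IsDist fun a => ‖φ a‖ ^ 2 := ⟨fun a => by positivity, hφ⟩
  rw [← (hd.pow n).sum_eq_one]
  simp [vecPow, Finset.prod_pow]

theorem relabel_withAncilla_vecPow (ρ : BiOp A B) (n : ℕ) :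
    relabel (Equiv.arrowProdEquivProdArrow (Fin n) (fun _ => A) (fun _ => A₀)).symm
      (Equiv.arrowProdEquivProdArrow (Fin n) (fun _ => B) (fun _ => B₀)).symm
      (withAncilla (tensorPow n ρ) (vecPow n φ) (vecPow n χ)) =
      tensorPow n (withAncilla ρ φ χ) := by
  ext ⟨a, b⟩ ⟨a', b'⟩
  simp [relabel, withAncilla, tensorPow, vecPow, Finset.prod_mul_distrib,
    Equiv.arrowProdEquivProdArrow]

theorem locInfo_relabel {ρ : BiOp A B} (hρ : IsState ρ) (e : A ≃ A') (f : B ≃ B') :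
    locInfo (relabel e f ρ) = locInfo ρ := by
  refine le_antisymm ((reach_relabel e f ρ).locInfo_le hρ) ?_
  have h : relabel e.symm f.symm (relabel e f ρ) = ρ := by
    ext i j
    simp [relabel]
  have hr := reach_relabel e.symm f.symm (relabel e f ρ)
  rw [h] at hr
  exact hr.locInfo_le ((reach_relabel e f ρ).isState hρ)

/-- Up to regrouping, n copies of an ancilla are one ancilla for n copies, so the bounds for the
catalytic quantity apply. -/
theorem locInfo_tensorPow_withAncilla {ρ : BiOp A B} (hρ : IsState ρ) (hφ : ‖φ‖ = 1)
    (hχ : ‖χ‖ = 1) (n : ℕ) : locInfo (tensorPow n (withAncilla ρ φ χ)) =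
      locInfo (withAncilla (tensorPow n ρ) (vecPow n φ) (vecPow n χ)) := by
  rw [← relabel_withAncilla_vecPow, locInfo_relabel]
  exact isState_withAncilla (isState_tensorPow hρ n) (norm_vecPow n hφ) (norm_vecPow n hχ)

/-- The regularised localisable information exists and is the supremum of its approximants. -/
theorem exists_tendsto_locInfo {ρ : BiOp A B} (hρ : IsState ρ) :
    ∃ r : ℝ, Tendsto (fun n : ℕ => locInfo (tensorPow n ρ) / n) atTop (𝓝 r) ∧
      ∀ n : ℕ, 1 ≤ n → locInfo (tensorPow n ρ) ≤ n * r := by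
  -- Fekete's lemma, applied to the negative of a superadditive sequence.
  have hsub : Subadditive fun n => -locInfo (tensorPow n ρ) := fun m n => by
    have h1 := locInfo_add_le_tensor (isState_tensorPow hρ m) (isState_tensorPow hρ n)
    have h2 := (reach_tensorPow_add ρ m n).locInfo_le (isState_tensorPow hρ _)
    simp only
    linarith
  have hbdd : BddBelow (Set.range fun n : ℕ => -locInfo (tensorPow n ρ) / n) := by
    refine ⟨-Real.logb 2 (Fintype.card A * Fintype.card B), ?_⟩
    rintro _ ⟨n, rfl⟩
    rcases Nat.eq_zero_or_pos n with rfl | hn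
    · have := (locInfo_nonneg hρ).trans (locInfo_le hρ)
      simpa using this
    · have hn0 : (0 : ℝ) < n := by exact_mod_cast hn
      simp only
      rw [le_div_iff₀ hn0]
      have := locInfo_tensorPow_le hρ n
      linarith
  refine ⟨-hsub.lim, ?_, fun n hn => ?_⟩
  · refine (hsub.tendsto_lim hbdd).neg.congr fun n => ?_
    rw [neg_div, neg_neg]
  · have h := hsub.lim_le_div hbdd (n := n) (by omega)
    have hn0 : (0 : ℝ) < n := by exact_mod_cast hn
    rw [le_div_iff₀ hn0] at h
    linarith

end Ancilla

end LocalInfo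

end

theorem mainTheorem6 {A B : Type} [Fintype A] [DecidableEq A] [Fintype B] [DecidableEq B]
    (ρ : LocalInfo.BiOp A B) (hρ : LocalInfo.IsState ρ) :
    ∃ r : ℝ,
      Tendsto (fun n : ℕ => LocalInfo.locInfo (LocalInfo.tensorPow n ρ) / n) atTop (𝓝 r) ∧
      (∀ n : ℕ, BddAbove (LocalInfo.catLocInfoSet (LocalInfo.tensorPow n ρ))) ∧
      Tendsto (fun n : ℕ => LocalInfo.catLocInfo (LocalInfo.tensorPow n ρ) / n) atTop (𝓝 r) ∧
      ∀ (A₀ B₀ : Type) [Fintype A₀] [DecidableEq A₀] [Fintype B₀] [DecidableEq B₀]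
        (φ : EuclideanSpace ℂ A₀) (χ : EuclideanSpace ℂ B₀), ‖φ‖ = 1 → ‖χ‖ = 1 →
        Tendsto (fun n : ℕ => LocalInfo.locInfo
            (LocalInfo.tensorPow n (LocalInfo.withAncilla ρ φ χ)) / n) atTop
          (𝓝 (r + Real.logb 2 (Fintype.card A₀) + Real.logb 2 (Fintype.card B₀))) := by
  open LocalInfo in
  obtain ⟨r, hr, hle⟩ := exists_tendsto_locInfo hρ
  -- Squeezed between the localisable information per copy and `r`; the upper bound uses that
  -- ρ^{⊗n}, taken as a single system, has per-copy bound n·r.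
  have hcat : Tendsto (fun n : ℕ => catLocInfo (tensorPow n ρ) / n) atTop (𝓝 r) := by
    refine tendsto_of_tendsto_of_tendsto_of_le_of_le' hr tendsto_const_nhds
      (Eventually.of_forall fun n => ?_) ?_
    · exact div_le_div_of_nonneg_right (locInfo_le_catLocInfo (isState_tensorPow hρ n))
        (Nat.cast_nonneg n)
    · filter_upwards [eventually_ge_atTop 1] with n hn
      have hn0 : (0 : ℝ) < n := by exact_mod_cast hn
      rw [div_le_iff₀ hn0, mul_comm]
      exact catLocInfo_le (isState_tensorPow hρ n) (locInfo_tensorPow_tensorPow_le hρ hle hn)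
  refine ⟨r, hr, fun n => bddAbove_catLocInfoSet (isState_tensorPow hρ n), hcat, ?_⟩
  intro A₀ B₀ _ _ _ _ φ χ hφ hχ
  set a := Real.logb 2 (Fintype.card A₀)
  set b := Real.logb 2 (Fintype.card B₀)
  rw [add_assoc]
  have hlog : ∀ n : ℕ, Real.logb 2 (Fintype.card (Fin n → A₀)) +
      Real.logb 2 (Fintype.card (Fin n → B₀)) = n * (a + b) := fun n => by
    rw [Fintype.card_fun, Fintype.card_fun, Fintype.card_fin, Nat.cast_pow, Nat.cast_pow,
      Real.logb_pow, Real.logb_pow]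
    ring
  -- Below by extracting the ancillas separately, above by the catalytic quantity, both shifted by
  -- the information of the ancillas.
  refine tendsto_of_tendsto_of_tendsto_of_le_of_le' (hr.add_const (a + b)) (hcat.add_const (a + b))
    ?_ ?_
  all_goals
    filter_upwards [eventually_ge_atTop 1] with n hn
    have hn0 : (0 : ℝ) < n := by exact_mod_cast hn
    have hs := isState_tensorPow hρ n
    have hφn := norm_vecPow n hφ
    have hχn := norm_vecPow n hχ
    rw [locInfo_tensorPow_withAncilla hρ hφ hχ, div_add' _ _ _ hn0.ne']
    refine div_le_div_of_nonneg_right ?_ hn0.le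
  · have h := locInfo_add_le_withAncilla hs hφn hχn
    rw [hlog] at h
    linarith
  · have h := sub_le_catLocInfo hs hφn hχn
    rw [hlog] at h
    linarith
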